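/- \textbf{Conventions.} All $\infty$-categories are small strict $\infty$-categories, and $\infty$-functors are strict. An \emph{augmented directed complex} is a chain complex $K$ of abelian groups in degrees $\ge 0$ with an augmentation $e : K_0 \to \mathbb{Z}$ (so $e\,d = 0$) and a submonoid of \emph{positive} chains in each $K_i$. Steiner's $\infty$-category $\nu(K)$ has as $i$-cells the tables of positive chains $x^\varepsilon_k \in K_k$ ($\varepsilon = 0,1$, $0 \le k \le i$) with $d(x^\varepsilon_k) = x^1_{k-1} - x^0_{k-1}$ for $0 < k \le i$, $e(x^\varepsilon_0) = 1$ and $x^0_i = x^1_i$. The $j$-source (resp. $j$-target) of $x$ keeps the columns of degree $<j$ and has $x^0_j$ (resp. $x^1_j$) as both entries in degree $j$; units add columns of zeros; if the $j$-source of $x$ is the $j$-target of $y$, then $x *_j y$ has, in degrees $k \le j$, the entries $y^0_k$ (row $0$) and $x^1_k$ (row $1$), and in degrees $k > j$ the entries $x^\varepsilon_k + y^\varepsilon_k$. The complex $\mathsf{c}\Delta^m$ is the normalized chain complex of the standard $m$-simplex: its $p$-chains are freely generated by the tuples $0 \le i_0 < \dots < i_p \le m$, with the usual alternating differential, the augmentation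 $e(i_0) = 1$, and as positive chains those with nonnegative coefficients. The $m$-th \emph{oriental} is $\mathcal{O}_m = \nu(\mathsf{c}\Delta^m)$, and the \emph{Street nerve} of an $\infty$-category $C$ is the simplicial set $NC$ with $(NC)_n = \{\infty\text{-functors } \mathcal{O}_n \to C\}$. For an $n$-simplex $x$ of a simplicial set $X$ and $0 \le i_0 \le \dots \le i_p \le n$, write $x_{i_0,\dots,i_p}$ for the image of $x$ under the operator of $\Delta^p \to \Delta^n$, $k \mapsto i_k$. For a morphism $f : X \to Y$ of simplicial sets and an $m$-simplex $y$ of $Y$, the simplicial set $y\backslash X$ is \[ (y\backslash X)_n = \{(y' \in Y_{m+1+n},\ x \in X_n) \mid y'_{0,\dots,m} = y,\ y'_{m+1,\dots,m+1+n} = f(x)\}, \] where $\psi : \Delta^{n'} \to \Delta^n$ acts on $x$ by $\psi$ and on $y'$ by the map $\Delta^{m+1+n'} \to \Delta^{m+1+n}$ that is the identity on $0,\dots,m$ and sends $m+1+l$ to $m+1+\psi(l)$. \textbf{Theorem.} Let $A$ and $B$ be two $\infty$-categories, $u : NA \to NB$ a morphism of simplicial sets, $m \ge 0$ an integer, $b$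 an $m$-simplex of $NB$, and $b_m$ its last vertex. Let \[ r : b\backslash NA \to b_m\backslash NA, \qquad (y, x) \mapsto (y_{m,m+1,\dots,m+1+n}, x) \] (where $(y,x)$ is an $n$-simplex of $b\backslash NA$). Then $r$ admits a section $s$ which makes $b_m\backslash NA$ a strong deformation retract of $b\backslash NA$: one has $rs = 1$, and there is a simplicial homotopy $h : \Delta^1 \times (b\backslash NA) \to b\backslash NA$ from $sr$ to the identity such that $h \circ (1_{\Delta^1} \times s) = s \circ \mathrm{pr}_2$. In particular, $r$ is a weak equivalence of simplicial sets. -/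

import Mathlib

open CategoryTheory Simplicial Opposite MonoidalCategory

universe u v w

/-! ### Strict ∞-categories and strict ∞-functors -/

/-- A small strict ∞-category: sets `cell i` of `i`-cells, iterated sources, targets and units,
and, for `j < i`, the composition `x *_j y` of the pairs of `i`-cells with `s_j x = t_j y`. -/
structure StrictInfCat : Type (u + 1) where
  cell : ℕ → Type u
  /-- `src j _ x` is the iterated source `s_j x` (which is `x` for `j = i`). -/
  src : ∀ {i : ℕ} (j : ℕ), j ≤ i → cell i → cell j
  /-- `tgt j _ x` is the iterated target `t_j x` (which is `x` for `j = i`). -/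
  tgt : ∀ {i : ℕ} (j : ℕ), j ≤ i → cell i → cell j
  /-- `one i _ x` is the iterated unit of `x`, an `i`-cell. -/
  one : ∀ {j : ℕ} (i : ℕ), j ≤ i → cell j → cell i
  comp : ∀ {i : ℕ} (j : ℕ) (h : j < i) (x y : cell i), src j h.le x = tgt j h.le y → cell i
  src_self : ∀ {i : ℕ} (h : i ≤ i) (x : cell i), src i h x = x
  tgt_self : ∀ {i : ℕ} (h : i ≤ i) (x : cell i), tgt i h x = x
  one_self : ∀ {i : ℕ} (h : i ≤ i) (x : cell i), one i h x = x
  src_src : ∀ {i j k : ℕ} (hkj : k ≤ j) (hji : j ≤ i) (x : cell i),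
    src k hkj (src j hji x) = src k (hkj.trans hji) x
  tgt_tgt : ∀ {i j k : ℕ} (hkj : k ≤ j) (hji : j ≤ i) (x : cell i),
    tgt k hkj (tgt j hji x) = tgt k (hkj.trans hji) x
  src_tgt : ∀ {i j k : ℕ} (hkj : k < j) (hji : j ≤ i) (x : cell i),
    src k hkj.le (tgt j hji x) = src k (hkj.le.trans hji) x
  tgt_src : ∀ {i j k : ℕ} (hkj : k < j) (hji : j ≤ i) (x : cell i),
    tgt k hkj.le (src j hji x) = tgt k (hkj.le.trans hji) x
  one_one : ∀ {i j k : ℕ} (hkj : k ≤ j) (hji : j ≤ i) (x : cell k),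
    one i hji (one j hkj x) = one i (hkj.trans hji) x
  src_one : ∀ {i j : ℕ} (h : j ≤ i) (x : cell j), src j h (one i h x) = x
  tgt_one : ∀ {i j : ℕ} (h : j ≤ i) (x : cell j), tgt j h (one i h x) = x
  src_comp : ∀ {i j : ℕ} (h : j < i) (x y : cell i) (hxy : src j h.le x = tgt j h.le y),
    src j h.le (comp j h x y hxy) = src j h.le y
  tgt_comp : ∀ {i j : ℕ} (h : j < i) (x y : cell i) (hxy : src j h.le x = tgt j h.le y),
    tgt j h.le (comp j h x y hxy) = tgt j h.le x
  src_comp_of_lt : ∀ {i j k : ℕ} (hjk : j < k) (hki : k ≤ i) (x y : cell i)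
    (hxy : src j (hjk.le.trans hki) x = tgt j (hjk.le.trans hki) y)
    (hxy' : src j hjk.le (src k hki x) = tgt j hjk.le (src k hki y)),
    src k hki (comp j (hjk.trans_le hki) x y hxy) = comp j hjk (src k hki x) (src k hki y) hxy'
  tgt_comp_of_lt : ∀ {i j k : ℕ} (hjk : j < k) (hki : k ≤ i) (x y : cell i)
    (hxy : src j (hjk.le.trans hki) x = tgt j (hjk.le.trans hki) y)
    (hxy' : src j hjk.le (tgt k hki x) = tgt j hjk.le (tgt k hki y)),
    tgt k hki (comp j (hjk.trans_le hki) x y hxy) = comp j hjk (tgt k hki x) (tgt k hki y) hxy'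
  one_comp : ∀ {i j k : ℕ} (hjk : j < k) (hki : k ≤ i) (x y : cell k)
    (hxy : src j hjk.le x = tgt j hjk.le y)
    (hxy' : src j (hjk.trans_le hki).le (one i hki x) = tgt j (hjk.trans_le hki).le (one i hki y)),
    one i hki (comp j hjk x y hxy) = comp j (hjk.trans_le hki) (one i hki x) (one i hki y) hxy'
  unit_comp : ∀ {i j : ℕ} (h : j < i) (x : cell i)
    (hx : src j h.le (one i h.le (tgt j h.le x)) = tgt j h.le x),
    comp j h (one i h.le (tgt j h.le x)) x hx = x
  comp_unit : ∀ {i j : ℕ} (h : j < i) (x : cell i)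
    (hx : src j h.le x = tgt j h.le (one i h.le (src j h.le x))),
    comp j h x (one i h.le (src j h.le x)) hx = x
  assoc : ∀ {i j : ℕ} (h : j < i) (x y z : cell i)
    (hxy : src j h.le x = tgt j h.le y) (hyz : src j h.le y = tgt j h.le z)
    (h₁ : src j h.le (comp j h x y hxy) = tgt j h.le z)
    (h₂ : src j h.le x = tgt j h.le (comp j h y z hyz)),
    comp j h (comp j h x y hxy) z h₁ = comp j h x (comp j h y z hyz) h₂
  interchange : ∀ {i j k : ℕ} (hkj : k < j) (hji : j < i) (x y z t : cell i)
    (hxy : src j hji.le x = tgt j hji.le y) (hzt : src j hji.le z = tgt j hji.le t)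
    (hxz : src k (hkj.trans hji).le x = tgt k (hkj.trans hji).le z)
    (hyt : src k (hkj.trans hji).le y = tgt k (hkj.trans hji).le t)
    (h₁ : src k (hkj.trans hji).le (comp j hji x y hxy) =
      tgt k (hkj.trans hji).le (comp j hji z t hzt))
    (h₂ : src j hji.le (comp k (hkj.trans hji) x z hxz) =
      tgt j hji.le (comp k (hkj.trans hji) y t hyt)),
    comp k (hkj.trans hji) (comp j hji x y hxy) (comp j hji z t hzt) h₁ =
      comp j hji (comp k (hkj.trans hji) x z hxz) (comp k (hkj.trans hji) y t hyt) h₂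

/-- A strict ∞-functor. -/
@[ext]
structure StrictInfFunctor (C : StrictInfCat.{v}) (D : StrictInfCat.{w}) : Type (max v w) where
  map : ∀ i : ℕ, C.cell i → D.cell i
  map_src : ∀ {i j : ℕ} (h : j ≤ i) (x : C.cell i), map j (C.src j h x) = D.src j h (map i x)
  map_tgt : ∀ {i j : ℕ} (h : j ≤ i) (x : C.cell i), map j (C.tgt j h x) = D.tgt j h (map i x)
  map_one : ∀ {i j : ℕ} (h : j ≤ i) (x : C.cell j), map i (C.one i h x) = D.one i h (map j x)
  map_comp : ∀ {i j : ℕ} (h : j < i) (x y : C.cell i) (hxy : C.src j h.le x = C.tgt j h.le y),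
    map i (C.comp j h x y hxy) =
      D.comp j h (map i x) (map i y) (by rw [← map_src, ← map_tgt, hxy])

namespace StrictInfFunctor

/-- The composite `G ∘ F` of two strict ∞-functors. -/
def comp {C : StrictInfCat.{u}} {D : StrictInfCat.{v}} {E : StrictInfCat.{w}}
    (G : StrictInfFunctor D E) (F : StrictInfFunctor C D) : StrictInfFunctor C E where
  map i x := G.map i (F.map i x)
  map_src h x := by rw [F.map_src, G.map_src]
  map_tgt h x := by rw [F.map_tgt, G.map_tgt]
  map_one h x := by rw [F.map_one, G.map_one]
  map_comp h x y hxy := by rw [F.map_comp, G.map_comp]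

end StrictInfFunctor

/-! ### Augmented directed complexes and the associated strict ∞-categories -/

/-- An augmented directed complex: a chain complex of abelian groups in nonnegative degrees with
an augmentation and a submonoid of positive chains in each degree. -/
structure ADC : Type (v + 1) where
  chain : ℕ → Type v
  [addCommGroup : ∀ i, AddCommGroup (chain i)]
  d : ∀ i, chain (i + 1) →+ chain i
  d_d : ∀ i x, d i (d (i + 1) x) = 0
  aug : chain 0 →+ ℤ
  aug_d : ∀ x, aug (d 0 x) = 0
  pos : ∀ i, AddSubmonoid (chain i)

attribute [instance] ADC.addCommGroup

/-- A morphism of augmented directed complexes. -/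
@[ext]
structure ADCHom (K : ADC.{v}) (L : ADC.{w}) : Type (max v w) where
  map : ∀ i, K.chain i →+ L.chain i
  map_d : ∀ i x, map i (K.d i x) = L.d i (map (i + 1) x)
  aug_map : ∀ x, L.aug (map 0 x) = K.aug x
  map_pos : ∀ i x, x ∈ K.pos i → map i x ∈ L.pos i

/-- The `i`-cells of `ν K`: the tables of positive chains `ch ε k`, for `ε = 0, 1` and
`0 ≤ k ≤ i`, such that `d (ch ε k) = ch 1 (k - 1) - ch 0 (k - 1)` for `0 < k ≤ i`,
`ch ε 0` has augmentation `1`, and `ch 0 i = ch 1 i`. A table is extended by zero in the degrees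
`k > i`. -/
@[ext]
structure NuCell (K : ADC.{v}) (i : ℕ) : Type v where
  ch : Fin 2 → ∀ k : ℕ, K.chain k
  pos : ∀ ε k, ch ε k ∈ K.pos k
  d_ch : ∀ ε k, k < i → K.d k (ch ε (k + 1)) = ch 1 k - ch 0 k
  aug_ch : ∀ ε, K.aug (ch ε 0) = 1
  top : ch 0 i = ch 1 i
  vanish : ∀ ε k, i < k → ch ε k = 0

namespace NuCell

variable {K : ADC.{v}} {i : ℕ}

/-- The iterated source (`η = 0`) or target (`η = 1`) of a cell of `ν K`: the columns of degree
`< j` are kept, and both entries in degree `j` become `x.ch η j`. -/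
def bd (η : Fin 2) (j : ℕ) (h : j ≤ i) (x : NuCell K i) : NuCell K j where
  ch ε k := if k < j then x.ch ε k else if k = j then x.ch η k else 0
  pos ε k := by
    split_ifs
    · exact x.pos ε k
    · exact x.pos η k
    · exact zero_mem _
  d_ch ε k hk := by
    rw [if_pos hk, if_pos hk]
    by_cases h' : k + 1 < j
    · rw [if_pos h']; exact x.d_ch ε k (by omega)
    · rw [if_neg h', if_pos (by omega)]; exact x.d_ch η k (by omega)
  aug_ch ε := by
    by_cases h0 : 0 < j
    · rw [if_pos h0]; exact x.aug_ch ε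
    · rw [if_neg h0, if_pos (by omega)]; exact x.aug_ch η
  top := by simp
  vanish ε k hk := by rw [if_neg (by omega), if_neg (by omega)]

/-- The iterated unit of a cell of `ν K`: columns of zeros are added. -/
def unit {j : ℕ} (i : ℕ) (h : j ≤ i) (x : NuCell K j) : NuCell K i where
  ch := x.ch
  pos := x.pos
  d_ch ε k hk := by
    rcases lt_trichotomy k j with hkj | rfl | hkj
    · exact x.d_ch ε k hkj
    · rw [x.vanish ε _ (Nat.lt_succ_self _), x.top]; simp
    · rw [x.vanish _ _ hkj, x.vanish _ _ hkj, x.vanish _ (k + 1) (by omega)]; simp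
  aug_ch := x.aug_ch
  top := by
    rcases h.eq_or_lt with rfl | h
    · exact x.top
    · rw [x.vanish _ _ h, x.vanish _ _ h]
  vanish ε k hk := x.vanish ε k (by omega)

lemma ch_eq_of_bd_eq {j : ℕ} {h : j ≤ i} {x y : NuCell K i} (hxy : x.bd 0 j h = y.bd 1 j h) :
    (∀ ε k, k < j → x.ch ε k = y.ch ε k) ∧ x.ch 0 j = y.ch 1 j := by
  refine ⟨fun ε k hk => ?_, ?_⟩
  · have := congrFun (congrFun (congrArg NuCell.ch hxy) ε) k
    simpa [bd, hk] using this
  · have := congrFun (congrFun (congrArg NuCell.ch hxy) 0) j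
    simpa [bd] using this

/-- The composite `x *_j y`: the columns of degree `≤ j` are those of `y` in the row `0` and those
of `x` in the row `1`, and the columns of degree `> j` are added. -/
def comp (j : ℕ) (h : j < i) (x y : NuCell K i) (hxy : x.bd 0 j h.le = y.bd 1 j h.le) :
    NuCell K i where
  ch ε k := if k ≤ j then (if ε = 0 then y.ch ε k else x.ch ε k) else x.ch ε k + y.ch ε k
  pos ε k := by
    split_ifs
    · exact y.pos ε k
    · exact x.pos ε k
    · exact add_mem (x.pos ε k) (y.pos ε k)
  d_ch ε k hk := by
    obtain ⟨h1, h2⟩ := ch_eq_of_bd_eq hxy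
    have hx := x.d_ch ε k hk
    have hy := y.d_ch ε k hk
    rcases lt_trichotomy k j with hkj | rfl | hkj
    · have h3 : k + 1 ≤ j := hkj
      rw [h1 _ _ hkj, h1 _ _ hkj] at hx
      simp only [h3, hkj.le, if_true, one_ne_zero, if_false, h1 _ _ hkj]
      split_ifs
      · exact hy
      · exact hx
    · have h3 : ¬ k + 1 ≤ k := by omega
      simp only [h3, le_refl, if_true, one_ne_zero, if_false, map_add, hx, hy, h2]
      abel
    · have h3 : ¬ k + 1 ≤ j := by omega
      simp only [h3, hkj.not_ge, if_false, map_add, hx, hy]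
      abel
  aug_ch ε := by
    rw [if_pos (Nat.zero_le _)]
    split_ifs
    · exact y.aug_ch ε
    · exact x.aug_ch ε
  top := by rw [if_neg (by omega), if_neg (by omega), x.top, y.top]
  vanish ε k hk := by rw [if_neg (by omega), x.vanish ε k hk, y.vanish ε k hk, add_zero]

end NuCell

namespace ADC

/-- The strict ∞-category `ν K` associated with an augmented directed complex `K`. -/
def nu (K : ADC.{v}) : StrictInfCat.{v} where
  cell := NuCell K
  src j h x := x.bd 0 j h
  tgt j h x := x.bd 1 j h
  one i h x := x.unit i h
  comp j h x y hxy := x.comp j h y hxy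
  src_self {i} h x := by
    ext ε k
    simp only [NuCell.bd]
    split_ifs with h1 h2
    · rfl
    · subst h2
      revert ε
      simp [Fin.forall_fin_two, x.top]
    · exact (x.vanish ε k (by omega)).symm
  tgt_self {i} h x := by
    ext ε k
    simp only [NuCell.bd]
    split_ifs with h1 h2
    · rfl
    · subst h2
      revert ε
      simp [Fin.forall_fin_two, x.top]
    · exact (x.vanish ε k (by omega)).symm
  one_self h x := rfl
  src_src hkj hji x := by
    ext ε l
    simp only [NuCell.bd]
    split_ifs <;> first | rfl | omega
  tgt_tgt hkj hji x := by
    ext ε l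
    simp only [NuCell.bd]
    split_ifs <;> first | rfl | omega
  src_tgt hkj hji x := by
    ext ε l
    simp only [NuCell.bd]
    split_ifs <;> first | rfl | omega
  tgt_src hkj hji x := by
    ext ε l
    simp only [NuCell.bd]
    split_ifs <;> first | rfl | omega
  one_one hkj hji x := rfl
  src_one {i j} h x := by
    ext ε k
    simp only [NuCell.bd, NuCell.unit]
    split_ifs with h1 h2
    · rfl
    · subst h2
      revert ε
      simp [Fin.forall_fin_two, x.top]
    · exact (x.vanish ε k (by omega)).symm
  tgt_one {i j} h x := by
    ext ε k
    simp only [NuCell.bd, NuCell.unit]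
    split_ifs with h1 h2
    · rfl
    · subst h2
      revert ε
      simp [Fin.forall_fin_two, x.top]
    · exact (x.vanish ε k (by omega)).symm
  src_comp {i j} h x y hxy := by
    obtain ⟨h1, -⟩ := NuCell.ch_eq_of_bd_eq hxy
    ext ε k
    simp only [NuCell.bd, NuCell.comp]
    split_ifs with h2 h3 h4 h5 h6 <;> first | rfl | omega | exact h1 _ _ (by assumption)
  tgt_comp {i j} h x y hxy := by
    obtain ⟨h1, -⟩ := NuCell.ch_eq_of_bd_eq hxy
    ext ε k
    simp only [NuCell.bd, NuCell.comp]
    split_ifs with h2 h3 h4 h5 h6 <;>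
      first | rfl | omega | (exact (h1 _ _ (by assumption)).symm)
  src_comp_of_lt {i j k} hjk hki x y hxy hxy' := by
    ext ε l
    simp only [NuCell.bd, NuCell.comp]
    split_ifs <;> first | rfl | omega | simp
  tgt_comp_of_lt {i j k} hjk hki x y hxy hxy' := by
    ext ε l
    simp only [NuCell.bd, NuCell.comp]
    split_ifs <;> first | rfl | omega | simp
  one_comp hjk hki x y hxy hxy' := rfl
  unit_comp {i j} h x hx := by
    ext ε k
    simp only [NuCell.bd, NuCell.comp, NuCell.unit]
    split_ifs with h1 h2 h3 h4 h5 <;> first | rfl | omega | (exact zero_add _) | skip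
    rw [show ε = 1 by omega]
  comp_unit {i j} h x hx := by
    ext ε k
    simp only [NuCell.bd, NuCell.comp, NuCell.unit]
    split_ifs with h1 h2 h3 h4 h5 <;> first | rfl | omega | (exact add_zero _) | skip
    rw [h2]
  assoc {i j} h x y z hxy hyz h₁ h₂ := by
    ext ε k
    simp only [NuCell.comp]
    split_ifs <;> first | rfl | exact add_assoc _ _ _
  interchange {i j k} hkj hji x y z t hxy hzt hxz hyt h₁ h₂ := by
    ext ε l
    simp only [NuCell.comp]
    split_ifs <;> first | rfl | omega | (exact add_add_add_comm _ _ _ _)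

/-- The strict ∞-functor `ν f` induced by a morphism `f` of augmented directed complexes. -/
def nuMap {K : ADC.{v}} {L : ADC.{w}} (f : ADCHom K L) : StrictInfFunctor K.nu L.nu where
  map i x :=
    { ch ε k := f.map k (x.ch ε k)
      pos ε k := f.map_pos k _ (x.pos ε k)
      d_ch ε k hk := by rw [← f.map_d, x.d_ch ε k hk, map_sub]
      aug_ch ε := by rw [f.aug_map, x.aug_ch]
      top := by rw [x.top]
      vanish ε k hk := by rw [x.vanish ε k hk, map_zero] }
  map_src h x := by
    apply NuCell.ext
    funext ε k
    simp only [nu, NuCell.bd]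
    split_ifs <;> simp
  map_tgt h x := by
    apply NuCell.ext
    funext ε k
    simp only [nu, NuCell.bd]
    split_ifs <;> simp
  map_one h x := rfl
  map_comp h x y hxy := by
    apply NuCell.ext
    funext ε k
    simp only [nu, NuCell.comp]
    split_ifs <;> simp

end ADC

/-! ### The augmented directed complexes of the standard simplices -/

namespace StdSimplexChain

/-- The chain `(v 0, …, v p)` of the standard `m`-simplex: the basis element if `v` is strictly
increasing, and `0` otherwise. -/
noncomputable def tuple {m p : ℕ} (v : Fin (p + 1) → Fin (m + 1)) :
    (Fin (p + 1) ↪o Fin (m + 1)) →₀ ℤ :=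
  open scoped Classical in
  if h : StrictMono v then Finsupp.single (OrderEmbedding.ofStrictMono v h) 1 else 0

lemma tuple_of_not_strictMono {m p : ℕ} {v : Fin (p + 1) → Fin (m + 1)} (h : ¬ StrictMono v) :
    tuple v = 0 := dif_neg h

lemma tuple_coe {m p : ℕ} (v : Fin (p + 1) ↪o Fin (m + 1)) :
    tuple (v : Fin (p + 1) → Fin (m + 1)) = Finsupp.single v 1 := by
  rw [tuple, dif_pos v.strictMono]
  rfl

/-- The differential `d (v 0, …, v (p + 1)) = ∑ k, (-1) ^ k (v 0, …, v (k - 1), v (k + 1), …)`. -/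
noncomputable def d (m p : ℕ) :
    ((Fin (p + 1 + 1) ↪o Fin (m + 1)) →₀ ℤ) →+ ((Fin (p + 1) ↪o Fin (m + 1)) →₀ ℤ) :=
  (Finsupp.linearCombination ℤ fun v : Fin (p + 1 + 1) ↪o Fin (m + 1) =>
    ∑ k : Fin (p + 2), (-1 : ℤ) ^ (k : ℕ) • tuple (v ∘ k.succAbove)).toAddMonoidHom

/-- The map `(v 0, …, v p) ↦ (φ (v 0), …, φ (v p))` induced by a monotone map `φ`. -/
noncomputable def map {m n : ℕ} (φ : Fin (m + 1) →o Fin (n + 1)) (p : ℕ) :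
    ((Fin (p + 1) ↪o Fin (m + 1)) →₀ ℤ) →+ ((Fin (p + 1) ↪o Fin (n + 1)) →₀ ℤ) :=
  (Finsupp.linearCombination ℤ fun v : Fin (p + 1) ↪o Fin (m + 1) =>
    tuple (φ ∘ v)).toAddMonoidHom

/-- The augmentation, which sends each `(v 0)` to `1`. -/
noncomputable def aug (m : ℕ) : ((Fin (0 + 1) ↪o Fin (m + 1)) →₀ ℤ) →+ ℤ :=
  (Finsupp.linearCombination ℤ fun _ : Fin (0 + 1) ↪o Fin (m + 1) => (1 : ℤ)).toAddMonoidHom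

/-- The chains with nonnegative coefficients. -/
def pos (m p : ℕ) : AddSubmonoid ((Fin (p + 1) ↪o Fin (m + 1)) →₀ ℤ) where
  carrier := {c | ∀ v, 0 ≤ c v}
  zero_mem' _ := le_rfl
  add_mem' ha hb v := add_nonneg (ha v) (hb v)

lemma hom_ext {m p : ℕ} {M : Type*} [AddCommGroup M]
    {f g : ((Fin (p + 1) ↪o Fin (m + 1)) →₀ ℤ) →+ M}
    (h : ∀ v : Fin (p + 1) ↪o Fin (m + 1), f (tuple v) = g (tuple v)) : f = g := by
  refine Finsupp.addHom_ext' fun v => AddMonoidHom.ext_int ?_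
  simpa [tuple_coe] using h v

lemma map_tuple {m n : ℕ} (φ : Fin (m + 1) →o Fin (n + 1)) {p : ℕ}
    (v : Fin (p + 1) → Fin (m + 1)) : map φ p (tuple v) = tuple (φ ∘ v) := by
  by_cases h : StrictMono v
  · have := tuple_coe (OrderEmbedding.ofStrictMono v h)
    rw [OrderEmbedding.coe_ofStrictMono] at this
    rw [this]
    simp [map]
  · rw [tuple_of_not_strictMono h, map_zero, tuple_of_not_strictMono]
    exact fun h' => h fun i j hij => φ.monotone.reflect_lt (h' hij)

lemma d_tuple {m p : ℕ} (v : Fin (p + 1 + 1) → Fin (m + 1)) (hv : Monotone v) :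
    d m p (tuple v) = ∑ k : Fin (p + 2), (-1 : ℤ) ^ (k : ℕ) • tuple (v ∘ k.succAbove) := by
  by_cases h : StrictMono v
  · have := tuple_coe (OrderEmbedding.ofStrictMono v h)
    rw [OrderEmbedding.coe_ofStrictMono] at this
    rw [this]
    simp [d]
  · rw [tuple_of_not_strictMono h, map_zero]
    obtain ⟨k, hk⟩ : ∃ k : Fin (p + 1), v k.castSucc = v k.succ := by
      by_contra! hne
      exact h (Fin.strictMono_iff_lt_succ.2 fun k =>
        lt_of_le_of_ne (hv (Fin.castSucc_lt_succ).le) (hne k))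
    have hz : ∀ l : Fin (p + 2), l ≠ k.castSucc → l ≠ k.succ → tuple (v ∘ l.succAbove) = 0 := by
      intro l h1 h2
      apply tuple_of_not_strictMono
      intro hs
      obtain ⟨a, ha⟩ := Fin.exists_succAbove_eq h1.symm
      obtain ⟨b, hb⟩ := Fin.exists_succAbove_eq h2.symm
      have : a = b := hs.injective (by simp [ha, hb, hk])
      subst this
      exact (Fin.castSucc_lt_succ (i := k)).ne (ha.symm.trans hb)
    have hs : v ∘ k.castSucc.succAbove = v ∘ k.succ.succAbove := by
      funext a
      simp only [Function.comp]
      rcases lt_trichotomy a k with hak | rfl | hak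
      · rw [Fin.succAbove_of_castSucc_lt _ _ (by simpa using hak),
          Fin.succAbove_of_castSucc_lt _ _ (by simpa using hak.le)]
      · simp [hk]
      · rw [Fin.succAbove_of_le_castSucc _ _ (by simpa using hak.le),
          Fin.succAbove_of_le_castSucc _ _ (Fin.succ_le_castSucc_iff.2 hak)]
    rw [← Finset.sum_subset (Finset.subset_univ {k.castSucc, k.succ}),
      Finset.sum_pair (Fin.castSucc_lt_succ).ne, hs]
    · rw [← add_smul, Fin.val_castSucc, Fin.val_succ, pow_succ, mul_neg_one, add_neg_cancel, zero_smul]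
    · intro l _ hl
      simp only [Finset.mem_insert, Finset.mem_singleton, not_or] at hl
      rw [hz l hl.1 hl.2, smul_zero]

lemma d_d (m p : ℕ) (x : (Fin (p + 1 + 1 + 1) ↪o Fin (m + 1)) →₀ ℤ) :
    d m p (d m (p + 1) x) = 0 := by
  suffices (d m p).comp (d m (p + 1)) = 0 from DFunLike.congr_fun this x
  refine hom_ext fun v => ?_
  rw [AddMonoidHom.comp_apply, d_tuple _ v.monotone, map_sum, AddMonoidHom.zero_apply]
  have : ∀ k : Fin (p + 3), d m p ((-1 : ℤ) ^ (k : ℕ) • tuple (v ∘ k.succAbove)) =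
      ∑ l : Fin (p + 2), ((-1 : ℤ) ^ (k : ℕ) * (-1 : ℤ) ^ (l : ℕ)) •
        tuple (v ∘ k.succAbove ∘ l.succAbove) := by
    intro k
    rw [map_zsmul, d_tuple _ (v.monotone.comp (Fin.strictMono_succAbove k).monotone),
      Finset.smul_sum]
    simp only [smul_smul, Function.comp_assoc]
  rw [Finset.sum_congr rfl fun k _ => this k, ← Finset.sum_product', Finset.univ_product_univ]
  refine Finset.sum_involution
    (fun (a : Fin (p + 3) × Fin (p + 2)) _ => (a.1.succAbove a.2, a.2.predAbove a.1)) ?_ ?_ ?_ ?_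
  · rintro ⟨k, l⟩ -
    have hv : v ∘ (k.succAbove l).succAbove ∘ (l.predAbove k).succAbove =
        v ∘ k.succAbove ∘ l.succAbove := by
      funext a
      simp only [Function.comp, Fin.succAbove_succAbove_succAbove_predAbove]
    rw [hv, ← add_smul, ← pow_add, ← pow_add, Fin.neg_one_pow_succAbove_add_predAbove,
      add_neg_cancel, zero_smul]
  · rintro ⟨k, l⟩ - - h
    exact Fin.succAbove_ne k l (congrArg Prod.fst h)
  · intros
    exact Finset.mem_univ _
  · rintro ⟨k, l⟩ -
    simp only [Fin.succAbove_succAbove_predAbove, Fin.predAbove_predAbove_succAbove]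

lemma map_mem_pos {m n : ℕ} (φ : Fin (m + 1) →o Fin (n + 1)) (p : ℕ)
    {x : (Fin (p + 1) ↪o Fin (m + 1)) →₀ ℤ} (hx : x ∈ pos m p) : map φ p x ∈ pos n p := by
  intro w
  have : map φ p x = x.sum fun v a => a • tuple (φ ∘ v) := Finsupp.linearCombination_apply _ _
  rw [this, Finsupp.sum_apply]
  refine Finset.sum_nonneg fun v _ => ?_
  dsimp only
  rw [Finsupp.smul_apply, smul_eq_mul]
  refine mul_nonneg (hx v) ?_
  rw [tuple]
  split_ifs
  · classical
    rw [Finsupp.single_apply]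
    split_ifs <;> simp
  · simp

lemma aug_d (m : ℕ) (x : (Fin (0 + 1 + 1) ↪o Fin (m + 1)) →₀ ℤ) : aug m (d m 0 x) = 0 := by
  suffices (aug m).comp (d m 0) = 0 from DFunLike.congr_fun this x
  refine hom_ext fun v => ?_
  have : ∀ w : Fin (0 + 1) → Fin (m + 1), aug m (tuple w) = 1 := by
    intro w
    have hw : StrictMono w := Subsingleton.strictMono (α := Fin 1) w
    have := tuple_coe (OrderEmbedding.ofStrictMono w hw)
    rw [OrderEmbedding.coe_ofStrictMono] at this
    rw [this]
    simp [aug]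
  rw [AddMonoidHom.comp_apply, d_tuple _ v.monotone, map_sum]
  simp [Fin.sum_univ_two, this]

end StdSimplexChain

/-- The augmented directed complex `c Δ^m` of the standard `m`-simplex: its `p`-chains are the free
abelian group on the tuples `0 ≤ i_0 < ⋯ < i_p ≤ m`. -/
noncomputable def simplexADC (m : ℕ) : ADC.{0} where
  chain p := (Fin (p + 1) ↪o Fin (m + 1)) →₀ ℤ
  d := StdSimplexChain.d m
  d_d := StdSimplexChain.d_d m
  aug := StdSimplexChain.aug m
  aug_d := StdSimplexChain.aug_d m
  pos := StdSimplexChain.pos m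

/-- The morphism `c φ : c Δ^m → c Δ^n` induced by a monotone map `φ`. -/
noncomputable def simplexADCMap {m n : ℕ} (φ : Fin (m + 1) →o Fin (n + 1)) :
    ADCHom (simplexADC m) (simplexADC n) where
  map := StdSimplexChain.map φ
  map_d p x := by
    suffices (StdSimplexChain.map φ p).comp (StdSimplexChain.d m p) =
        (StdSimplexChain.d n p).comp (StdSimplexChain.map φ (p + 1)) from DFunLike.congr_fun this x
    refine StdSimplexChain.hom_ext fun v => ?_
    rw [AddMonoidHom.comp_apply, AddMonoidHom.comp_apply, StdSimplexChain.map_tuple,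
      StdSimplexChain.d_tuple _ v.monotone,
      StdSimplexChain.d_tuple _ (φ.monotone.comp v.monotone), map_sum]
    simp only [map_zsmul, StdSimplexChain.map_tuple, Function.comp_assoc]
  aug_map x := by
    suffices (StdSimplexChain.aug n).comp (StdSimplexChain.map φ 0) = StdSimplexChain.aug m from
      DFunLike.congr_fun this x
    refine StdSimplexChain.hom_ext fun v => ?_
    have hw : StrictMono (φ ∘ v) := Subsingleton.strictMono (α := Fin 1) _
    have := StdSimplexChain.tuple_coe (OrderEmbedding.ofStrictMono (φ ∘ v) hw)
    rw [OrderEmbedding.coe_ofStrictMono] at this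
    rw [AddMonoidHom.comp_apply, StdSimplexChain.map_tuple, this, StdSimplexChain.tuple_coe]
    simp [StdSimplexChain.aug]
  map_pos p _ hx := StdSimplexChain.map_mem_pos φ p hx

/-! ### Orientals and the Street nerve -/

/-- The `m`-th oriental `O_m = ν c Δ^m`. -/
noncomputable def oriental (m : ℕ) : StrictInfCat.{0} := (simplexADC m).nu

/-- The strict ∞-functor `ν c φ : O_m → O_n` induced by a monotone map `φ`. -/
noncomputable def orientalMap {m n : ℕ} (φ : Fin (m + 1) →o Fin (n + 1)) :
    StrictInfFunctor (oriental m) (oriental n) :=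
  ADC.nuMap (simplexADCMap φ)

lemma simplexADCMap_id (m : ℕ) (p : ℕ) (x : (simplexADC m).chain p) :
    (simplexADCMap (OrderHom.id : Fin (m + 1) →o Fin (m + 1))).map p x = x := by
  suffices StdSimplexChain.map (OrderHom.id : Fin (m + 1) →o Fin (m + 1)) p = AddMonoidHom.id _ from
    DFunLike.congr_fun this x
  refine StdSimplexChain.hom_ext fun v => ?_
  rw [StdSimplexChain.map_tuple]
  rfl

lemma simplexADCMap_comp {l m n : ℕ} (ψ : Fin (m + 1) →o Fin (n + 1))
    (φ : Fin (l + 1) →o Fin (m + 1)) (p : ℕ) (x : (simplexADC l).chain p) :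
    (simplexADCMap (ψ.comp φ)).map p x = (simplexADCMap ψ).map p ((simplexADCMap φ).map p x) := by
  suffices StdSimplexChain.map (ψ.comp φ) p =
      (StdSimplexChain.map ψ p).comp (StdSimplexChain.map φ p) from DFunLike.congr_fun this x
  refine StdSimplexChain.hom_ext fun v => ?_
  rw [AddMonoidHom.comp_apply, StdSimplexChain.map_tuple, StdSimplexChain.map_tuple,
    StdSimplexChain.map_tuple]
  rfl

/-- The Street nerve `N C` of a strict ∞-category: its `n`-simplices are the strict ∞-functors
`O_n → C`. -/
noncomputable def streetNerve (C : StrictInfCat.{u}) : SSet.{u} where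
  obj n := StrictInfFunctor (oriental n.unop.len) C
  map φ := ↾fun y => y.comp (orientalMap φ.unop.toOrderHom)
  map_id n := by
    apply ConcreteCategory.hom_ext
    intro y
    apply StrictInfFunctor.ext
    funext i x
    refine congrArg (y.map i) (NuCell.ext ?_)
    funext ε k
    exact simplexADCMap_id _ _ _
  map_comp φ ψ := by
    apply ConcreteCategory.hom_ext
    intro y
    apply StrictInfFunctor.ext
    funext i x
    refine congrArg (y.map i) (NuCell.ext ?_)
    funext ε k
    exact simplexADCMap_comp _ _ _ _

/-! ### Slices of simplicial sets under a simplex -/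

namespace CosliceIndex

/-- The inclusion `Δ^m → Δ^(m+1+n)`, `k ↦ k`. -/
def initialIncl (m : ℕ) (n : SimplexCategory) : ⦋m⦌ ⟶ ⦋m + 1 + n.len⦌ :=
  SimplexCategory.Hom.mk
    { toFun := fun k => ⟨k.1, by have := k.2; simp only [SimplexCategory.len_mk] at this ⊢; omega⟩
      monotone' := fun _ _ h => h }

/-- The inclusion `Δ^n → Δ^(m+1+n)`, `l ↦ m + 1 + l`. -/
def finalIncl (m : ℕ) (n : SimplexCategory) : n ⟶ ⦋m + 1 + n.len⦌ :=
  SimplexCategory.Hom.mk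
    { toFun := fun l => ⟨m + 1 + l.1, by have := l.2; dsimp only [SimplexCategory.len_mk]; omega⟩
      monotone' := fun _ _ h => Nat.add_le_add_left h _ }

/-- The map `Δ^m ⨿ ψ : Δ^(m+1+n') → Δ^(m+1+n)` which is the identity on the first `m + 1` vertices
and sends `m + 1 + l` to `m + 1 + ψ l`. -/
def shift (m : ℕ) {n' n : SimplexCategory} (ψ : n' ⟶ n) : ⦋m + 1 + n'.len⦌ ⟶ ⦋m + 1 + n.len⦌ :=
  SimplexCategory.Hom.mk
    { toFun := fun i =>
        if h : i.1 ≤ m then ⟨i.1, by simp only [SimplexCategory.len_mk]; omega⟩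
        else ⟨m + 1 + (ψ.toOrderHom ⟨i.1 - (m + 1), by
            have := i.2; simp only [SimplexCategory.len_mk] at this; omega⟩).1, by
          simp only [SimplexCategory.len_mk]; omega⟩
      monotone' := by
        intro i j hij
        have hij' : i.1 ≤ j.1 := hij
        dsimp only
        split_ifs with h1 h2 h2
        · exact hij
        · rw [Fin.le_def]; dsimp only; omega
        · omega
        · rw [Fin.le_def]
          exact Nat.add_le_add_left (ψ.toOrderHom.monotone (by rw [Fin.le_def]; dsimp only; omega)) _ }

/-- The map `Δ^(1+n) → Δ^(m+1+n)`, `k ↦ m + k`. -/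
def tail (m : ℕ) (n : SimplexCategory) : ⦋0 + 1 + n.len⦌ ⟶ ⦋m + 1 + n.len⦌ :=
  SimplexCategory.Hom.mk
    { toFun := fun k => ⟨m + k.1, by
        have := k.2; simp only [SimplexCategory.len_mk] at this ⊢; omega⟩
      monotone' := fun _ _ h => Nat.add_le_add_left h _ }

lemma hom_ext {a b : SimplexCategory} {f g : a ⟶ b}
    (h : ∀ i, (f.toOrderHom i).1 = (g.toOrderHom i).1) : f = g := by
  ext i : 3
  exact Fin.ext (h i)

lemma shift_val (m : ℕ) {a b : SimplexCategory} (f : a ⟶ b) (i : Fin (m + 1 + a.len + 1))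
    (l : Fin (a.len + 1)) (h : i.1 = m + 1 + l.1) :
    ((shift m f).toOrderHom i).1 = m + 1 + (f.toOrderHom l).1 := by
  have hl : (⟨i.1 - (m + 1), by omega⟩ : Fin (a.len + 1)) = l := Fin.ext (by dsimp only; omega)
  have : ¬ i.1 ≤ m := by omega
  simp [shift, this, hl]

lemma shift_val_of_le (m : ℕ) {a b : SimplexCategory} (f : a ⟶ b) (i : Fin (m + 1 + a.len + 1))
    (h : i.1 ≤ m) : ((shift m f).toOrderHom i).1 = i.1 := by
  simp [shift, h]

lemma exists_val (m : ℕ) {a : SimplexCategory} (i : Fin (m + 1 + a.len + 1)) :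
    i.1 ≤ m ∨ ∃ l : Fin (a.len + 1), i.1 = m + 1 + l.1 := by
  rcases le_or_gt i.1 m with h | h
  · exact Or.inl h
  · exact Or.inr ⟨⟨i.1 - (m + 1), by omega⟩, by dsimp only; omega⟩

lemma shift_id (m : ℕ) (n : SimplexCategory) : shift m (𝟙 n) = 𝟙 _ := by
  refine hom_ext fun i => ?_
  rcases exists_val m i with h | ⟨l, h⟩
  · rw [shift_val_of_le m _ i h]; rfl
  · rw [shift_val m _ i l h]; exact h.symm

lemma shift_comp (m : ℕ) {a b c : SimplexCategory} (f : a ⟶ b) (g : b ⟶ c) :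
    shift m (f ≫ g) = shift m f ≫ shift m g := by
  refine hom_ext fun i => ?_
  change _ = ((shift m g).toOrderHom ((shift m f).toOrderHom i)).1
  rcases exists_val m i with h | ⟨l, h⟩
  · have h' := shift_val_of_le m f i h
    rw [shift_val_of_le m _ i h, shift_val_of_le m g _ (h'.trans_le h), h']
  · rw [shift_val m _ i l h, shift_val m g _ (f.toOrderHom l) (shift_val m f i l h)]
    rfl

lemma initialIncl_shift (m : ℕ) {a b : SimplexCategory} (f : a ⟶ b) :
    initialIncl m a ≫ shift m f = initialIncl m b :=
  hom_ext fun i => shift_val_of_le m f ((initialIncl m a).toOrderHom i) (Nat.le_of_lt_succ i.2)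

lemma finalIncl_shift (m : ℕ) {a b : SimplexCategory} (f : a ⟶ b) :
    finalIncl m a ≫ shift m f = f ≫ finalIncl m b :=
  hom_ext fun l => shift_val m f ((finalIncl m a).toOrderHom l) l rfl

lemma tail_shift (m : ℕ) {a b : SimplexCategory} (f : a ⟶ b) :
    tail m a ≫ shift m f = shift 0 f ≫ tail m b := by
  refine hom_ext fun i => ?_
  change ((shift m f).toOrderHom ((tail m a).toOrderHom i)).1 = m + ((shift 0 f).toOrderHom i).1
  have ht : ((tail m a).toOrderHom i).1 = m + i.1 := rfl
  rcases exists_val 0 i with h | ⟨l, h⟩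
  · rw [shift_val_of_le 0 f i h, shift_val_of_le m f _ (by omega), ht]
  · rw [shift_val 0 f i l h, shift_val m f _ l (by omega)]
    omega

lemma initialIncl_tail (m : ℕ) (n : SimplexCategory) :
    initialIncl 0 n ≫ tail m n =
      SimplexCategory.const ⦋0⦌ ⦋m⦌ (Fin.last m) ≫ initialIncl m n := by
  refine hom_ext fun i => ?_
  change m + i.1 = m
  have : i.1 < 0 + 1 := i.2
  omega

lemma finalIncl_tail (m : ℕ) (n : SimplexCategory) :
    finalIncl 0 n ≫ tail m n = finalIncl m n := by
  refine hom_ext fun i => ?_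
  change m + (0 + 1 + i.1) = m + 1 + i.1
  omega

end CosliceIndex

open CosliceIndex in
/-- For a morphism `f : X ⟶ Y` of simplicial sets and an `m`-simplex `y` of `Y`, the simplicial set
`y \ X`, whose `n`-simplices are the pairs of an `(m+1+n)`-simplex `y'` of `Y` and an `n`-simplex
`x` of `X` with `y'_{0,…,m} = y` and `y'_{m+1,…,m+1+n} = f x`. -/
def coslice {X Y : SSet.{u}} (f : X ⟶ Y) {m : ℕ} (y : Y _⦋m⦌) : SSet.{u} where
  obj n := {p : Y _⦋m + 1 + n.unop.len⦌ × X.obj n //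
    Y.map (initialIncl m n.unop).op p.1 = y ∧ Y.map (finalIncl m n.unop).op p.1 = f.app n p.2}
  map {n n'} ψ := ↾fun p => ⟨(Y.map (shift m ψ.unop).op p.1.1, X.map ψ p.1.2), by
    constructor
    · rw [← Functor.map_comp_apply, ← op_comp, initialIncl_shift, p.2.1]
    · rw [← Functor.map_comp_apply, ← op_comp, finalIncl_shift, op_comp,
        Functor.map_comp_apply, p.2.2, Quiver.Hom.op_unop]
      exact (NatTrans.naturality_apply f ψ p.1.2).symm⟩
  map_id n := by
    apply ConcreteCategory.hom_ext
    intro p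
    refine Subtype.ext (Prod.ext ?_ ?_)
    · change Y.map (shift m (𝟙 n.unop)).op p.1.1 = p.1.1
      rw [shift_id, op_id, Functor.map_id_apply]
    · exact Functor.map_id_apply X n p.1.2
  map_comp φ ψ := by
    apply ConcreteCategory.hom_ext
    intro p
    refine Subtype.ext (Prod.ext ?_ ?_)
    · change Y.map (shift m (ψ.unop ≫ φ.unop)).op p.1.1 =
        Y.map (shift m ψ.unop).op (Y.map (shift m φ.unop).op p.1.1)
      rw [shift_comp, op_comp, Functor.map_comp_apply]
    · exact Functor.map_comp_apply X φ ψ p.1.2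

/-- The last vertex `b_m` of an `m`-simplex `b`. -/
def lastVertex {Y : SSet.{u}} {m : ℕ} (b : Y _⦋m⦌) : Y _⦋0⦌ :=
  Y.map (SimplexCategory.const ⦋0⦌ ⦋m⦌ (Fin.last m)).op b

open CosliceIndex in
/-- The morphism `b \ X ⟶ b_m \ X`, `(y, x) ↦ (y_{m,m+1,…,m+1+n}, x)`. -/
def cosliceToLastVertex {X Y : SSet.{u}} (f : X ⟶ Y) {m : ℕ} (b : Y _⦋m⦌) :
    coslice f b ⟶ coslice f (lastVertex b) where
  app n := ↾fun p => ⟨(Y.map (tail m n.unop).op p.1.1, p.1.2), by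
    constructor
    · rw [← Functor.map_comp_apply, ← op_comp, initialIncl_tail, op_comp,
        Functor.map_comp_apply, p.2.1, lastVertex]
    · rw [← Functor.map_comp_apply, ← op_comp, finalIncl_tail, p.2.2]⟩
  naturality n n' ψ := by
    apply ConcreteCategory.hom_ext
    intro p
    refine Subtype.ext (Prod.ext ?_ rfl)
    change Y.map (tail m n'.unop).op (Y.map (shift m ψ.unop).op p.1.1) =
      Y.map (shift 0 ψ.unop).op (Y.map (tail m n.unop).op p.1.1)
    rw [← Functor.map_comp_apply, ← op_comp, tail_shift, op_comp, Functor.map_comp_apply]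

/-! ### Strong deformation retracts and simplicial weak equivalences -/

/-- The section `s` of `r` makes `Y` a strong deformation retract of `X`: there is a homotopy
`h : X ⊗ Δ[1] ⟶ X` from `r ≫ s` to the identity of `X` which is constant on `Y`. -/
def IsStrongDeformationRetract {X Y : SSet.{u}} (s : Y ⟶ X) (r : X ⟶ Y) : Prop :=
  s ≫ r = 𝟙 Y ∧ ∃ H : SSet.Homotopy (r ≫ s) (𝟙 X),
    s ▷ Δ[1] ≫ H.h = CartesianMonoidalCategory.fst Y Δ[1] ≫ s

/-- The set `[X, Z]` of homotopy classes of morphisms `X ⟶ Z` (for the equivalence relation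
generated by simplicial homotopy). -/
def HomotopyClasses (X Z : SSet.{u}) : Type u :=
  Quot fun f g : X ⟶ Z => Nonempty (SSet.Homotopy f g)

/-- The map `[Y, Z] → [X, Z]` induced by `f : X ⟶ Y`. -/
def HomotopyClasses.precomp {X Y : SSet.{u}} (f : X ⟶ Y) (Z : SSet.{u}) :
    HomotopyClasses Y Z → HomotopyClasses X Z :=
  Quot.map (fun g => f ≫ g) fun _ _ ⟨H⟩ =>
    ⟨H.precomp (SSet.RelativeMorphism.botEquiv.symm f)
      (SSet.Subcomplex.isInitialBot.hom_ext _ _)⟩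

/-- A morphism `f : X ⟶ Y` of simplicial sets is a weak equivalence if it induces a bijection
`[Y, Z] → [X, Z]` for every Kan complex `Z`. -/
def IsSimplicialWeakEquivalence {X Y : SSet.{u}} (f : X ⟶ Y) : Prop :=
  ∀ (Z : SSet.{u}) [SSet.KanComplex Z], Function.Bijective (HomotopyClasses.precomp f Z)

/-! Everything happens on the oriental `O_(m+1+n)` and its two faces `0, …, m` and `m, …, m+1+n`,
which share the vertex `m`. The maps `P : i ↦ min i m` and `Q : i ↦ i - m` project the oriental onto
these faces. Given ∞-functors `F` and `G` on the faces that agree at `m`, glue them by sending a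
cell `x` to `F (P x)` if its target vertex is at most `m`, to `G (Q x)` if its source vertex is at
least `m`, and to `G (Q x) *_0 F (P x)` otherwise. This is an ∞-functor because a cell of an
oriental which starts at the last vertex or ends at the first one is a unit
(`eq_unit_of_weight_le`). Gluing with `b` is the section `s`.

For the homotopy, let `α : n ⟶ ⦋1⦌`, let `φ` send `m+1+l` to `m` when `α l = 0` and fix the other
vertices, and let `μ = max (·) m`. These maps commute, and the chain map `φ + μ - μφ` preserves
positive chains, since a nondegenerate `μφ(v)` is equal to `φ(v)` or to `μ(v)`
(`collapse_comp_tailProj_eq_or`). Precomposition with the induced ∞-functor `deform m α` is the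
homotopy. For `α = 1` it is the identity; for `α = 0` it is the gluing of the two face inclusions
(`deform_of_eq_zero`), which gives `sr`. Both `P` and `Q` absorb `deform`, so glued ∞-functors do
not move.

The face `m+1, …, m+1+n` is left alone by every construction, so the component in `NA` never
changes; this is why `u` may be any simplicial map. -/

namespace StrictInfCat

/-! ### Units and iterated boundaries of composites. -/

variable (C : StrictInfCat.{u})

lemma comp_congr {i j : ℕ} (h : j < i) {x x' y y' : C.cell i} (hx : x = x') (hy : y = y')
    (hxy : C.src j h.le x = C.tgt j h.le y) (hxy' : C.src j h.le x' = C.tgt j h.le y') :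
    C.comp j h x y hxy = C.comp j h x' y' hxy' := by
  subst hx hy
  rfl

lemma comp_eq_left {i j : ℕ} (h : j < i) (x y : C.cell i) (c : C.cell j)
    (hy : y = C.one i h.le c) (hxy : C.src j h.le x = C.tgt j h.le y) :
    C.comp j h x y hxy = x := by
  have hc : c = C.src j h.le x := by rw [hxy, hy, C.tgt_one]
  subst hc hy
  exact C.comp_unit h x hxy

lemma comp_eq_right {i j : ℕ} (h : j < i) (x y : C.cell i) (c : C.cell j)
    (hx : x = C.one i h.le c) (hxy : C.src j h.le x = C.tgt j h.le y) :
    C.comp j h x y hxy = y := by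
  have hc : c = C.tgt j h.le y := by rw [← hxy, hx, C.src_one]
  subst hc hx
  exact C.unit_comp h y hxy

lemma tgt_comp_eq_left {i j k : ℕ} (hkj : k ≤ j) (hji : j < i) (x y : C.cell i)
    (hxy : C.src j hji.le x = C.tgt j hji.le y) :
    C.tgt k (hkj.trans hji.le) (C.comp j hji x y hxy) = C.tgt k (hkj.trans hji.le) x := by
  rw [← C.tgt_tgt hkj hji.le, C.tgt_comp, C.tgt_tgt]

lemma src_comp_eq_right {i j k : ℕ} (hkj : k ≤ j) (hji : j < i) (x y : C.cell i)
    (hxy : C.src j hji.le x = C.tgt j hji.le y) :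
    C.src k (hkj.trans hji.le) (C.comp j hji x y hxy) = C.src k (hkj.trans hji.le) y := by
  rw [← C.src_src hkj hji.le, C.src_comp, C.src_src]

lemma tgt_eq_of_composable {i j k : ℕ} (hkj : k < j) (hji : j ≤ i) {x y : C.cell i}
    (hxy : C.src j hji x = C.tgt j hji y) :
    C.tgt k (hkj.le.trans hji) x = C.tgt k (hkj.le.trans hji) y := by
  rw [← C.tgt_src hkj hji, hxy, C.tgt_tgt]

lemma src_eq_of_composable {i j k : ℕ} (hkj : k < j) (hji : j ≤ i) {x y : C.cell i}
    (hxy : C.src j hji x = C.tgt j hji y) :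
    C.src k (hkj.le.trans hji) x = C.src k (hkj.le.trans hji) y := by
  rw [← C.src_src hkj.le hji, hxy, C.src_tgt hkj]

lemma src_one_of_le {i j k : ℕ} (hkj : k ≤ j) (hji : j ≤ i) (c : C.cell k) :
    C.src j hji (C.one i (hkj.trans hji) c) = C.one j hkj c := by
  rw [← C.one_one hkj hji, C.src_one]

lemma tgt_one_of_le {i j k : ℕ} (hkj : k ≤ j) (hji : j ≤ i) (c : C.cell k) :
    C.tgt j hji (C.one i (hkj.trans hji) c) = C.one j hkj c := by
  rw [← C.one_one hkj hji, C.tgt_one]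

end StrictInfCat

/-! ### Gluing two ∞-functors along a `0`-cell. -/

namespace StrictInfFunctor

variable {O : StrictInfCat.{w}} {C D : StrictInfCat.{v}} {B : StrictInfCat.{u}}

open Classical in
/-- The value on a cell `x`, with images `y` in `C` and `z` in `D`, of the ∞-functor obtained by
gluing `F` and `G` along the `0`-cells `p` and `q`. -/
noncomputable def glueCell (F : StrictInfFunctor C B) (G : StrictInfFunctor D B)
    (p : C.cell 0) (q : D.cell 0) (i : ℕ) (y : C.cell i) (z : D.cell i) : B.cell i :=
  -- The first two branches cannot be absorbed into the composite: a cell on one side of the gluing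
  -- point need not touch it, and `*_0` does not exist in dimension `0`.
  if D.tgt 0 i.zero_le z = q then F.map i y
  else if C.src 0 i.zero_le y = p then G.map i z
  else if h : ∃ _ : 0 < i, B.src 0 i.zero_le (G.map i z) = B.tgt 0 i.zero_le (F.map i y) then
    B.comp 0 h.1 (G.map i z) (F.map i y) h.2
  -- A default value, never reached under `IsGluing` and `F p = G q`: a `0`-cell always falls into
  -- one of the first two branches.
  else G.map i z

/-- Two projections `P : O → C` and `Q : O → D` and `0`-cells `p` of `C` and `q` of `D` such that
`O` behaves like the gluing of `C` and `D` along `p` and `q`, with `p` a final vertex of `C` and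
`q` an initial vertex of `D`. -/
structure IsGluing (P : StrictInfFunctor O C) (Q : StrictInfFunctor O D)
    (p : C.cell 0) (q : D.cell 0) : Prop where
  eq_one_left : ∀ i (y : C.cell i), C.src 0 i.zero_le y = p → y = C.one i i.zero_le p
  eq_one_right : ∀ i (z : D.cell i), D.tgt 0 i.zero_le z = q → z = D.one i i.zero_le q
  cases : ∀ i (x : O.cell i), D.tgt 0 i.zero_le (Q.map i x) = q ∨
    C.src 0 i.zero_le (P.map i x) = p ∨
      C.tgt 0 i.zero_le (P.map i x) = p ∧ D.src 0 i.zero_le (Q.map i x) = q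

namespace IsGluing

variable {P : StrictInfFunctor O C} {Q : StrictInfFunctor O D} {p : C.cell 0} {q : D.cell 0}
  {F : StrictInfFunctor C B} {G : StrictInfFunctor D B}

lemma glueCell_of_tgt {i : ℕ} {y : C.cell i} {z : D.cell i} (hz : D.tgt 0 i.zero_le z = q) :
    glueCell F G p q i y z = F.map i y := if_pos hz

/-- Where the first branch takes precedence, `y` and `z` are units on `p` and `q`, and `F p = G q`.
-/
lemma glueCell_of_src (H : IsGluing P Q p q) (hpq : F.map 0 p = G.map 0 q) {i : ℕ}
    {y : C.cell i} {z : D.cell i} (hy : C.src 0 i.zero_le y = p) :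
    glueCell F G p q i y z = G.map i z := by
  by_cases hz : D.tgt 0 i.zero_le z = q
  · rw [glueCell_of_tgt hz, H.eq_one_left i y hy, H.eq_one_right i z hz, F.map_one, G.map_one, hpq]
  · rw [glueCell, if_neg hz, if_pos hy]

lemma composable (hpq : F.map 0 p = G.map 0 q) {i : ℕ} {y : C.cell i} {z : D.cell i}
    (hy : C.tgt 0 i.zero_le y = p) (hz : D.src 0 i.zero_le z = q) :
    B.src 0 i.zero_le (G.map i z) = B.tgt 0 i.zero_le (F.map i y) := by
  rw [← G.map_src, ← F.map_tgt, hy, hz, hpq]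

/-- On the overlap with the other branches, one factor of the composite is a unit. -/
lemma glueCell_of_composable (H : IsGluing P Q p q) (hpq : F.map 0 p = G.map 0 q) {i : ℕ}
    (hi : 0 < i) {y : C.cell i} {z : D.cell i} (hy : C.tgt 0 i.zero_le y = p)
    (hz : D.src 0 i.zero_le z = q) :
    glueCell F G p q i y z =
      B.comp 0 hi (G.map i z) (F.map i y) (composable hpq hy hz) := by
  by_cases hz' : D.tgt 0 i.zero_le z = q
  · rw [glueCell_of_tgt hz']
    exact (B.comp_eq_right hi _ _ (G.map 0 q)
      (by rw [← G.map_one, ← H.eq_one_right i z hz']) _).symm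
  · by_cases hy' : C.src 0 i.zero_le y = p
    · rw [H.glueCell_of_src hpq hy']
      exact (B.comp_eq_left hi _ _ (F.map 0 p)
        (by rw [← F.map_one, ← H.eq_one_left i y hy']) _).symm
    · rw [glueCell, if_neg hz', if_neg hy', dif_pos ⟨hi, composable hpq hy hz⟩]

lemma map_src_glueCell (H : IsGluing P Q p q) (hpq : F.map 0 p = G.map 0 q) {i j : ℕ} (h : j ≤ i)
    (x : O.cell i) :
    glueCell F G p q j (P.map j (O.src j h x)) (Q.map j (O.src j h x)) =
      B.src j h (glueCell F G p q i (P.map i x) (Q.map i x)) := by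
  rw [P.map_src, Q.map_src]
  rcases H.cases i x with hx | hx | ⟨hx, hx'⟩
  · rw [glueCell_of_tgt hx, glueCell_of_tgt, F.map_src]
    rw [H.eq_one_right i _ hx, D.src_one_of_le j.zero_le h, D.tgt_one]
  · rw [H.glueCell_of_src hpq hx, H.glueCell_of_src hpq, G.map_src]
    rw [C.src_src, hx]
  -- The `0`-source of the composite is that of its `F` factor; sources in positive dimension
  -- distribute over `*_0`.
  · rcases j.eq_zero_or_pos with rfl | hj
    · rw [glueCell_of_tgt (by rw [D.tgt_self, hx'])]
      rcases i.eq_zero_or_pos with rfl | hi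
      · rw [D.src_self] at hx'
        rw [glueCell_of_tgt (by rw [D.tgt_self, hx']), F.map_src]
      · rw [H.glueCell_of_composable hpq hi hx hx', B.src_comp, F.map_src]
    · rw [H.glueCell_of_composable hpq (hj.trans_le h) hx hx',
        H.glueCell_of_composable hpq hj (by rw [C.tgt_src hj, hx]) (by rw [D.src_src, hx']),
        B.src_comp_of_lt hj h _ _ _ (by
          rw [B.src_src, B.tgt_src hj]; exact composable hpq hx hx')]
      exact B.comp_congr hj (G.map_src _ _) (F.map_src _ _) _ _

lemma map_tgt_glueCell (H : IsGluing P Q p q) (hpq : F.map 0 p = G.map 0 q) {i j : ℕ} (h : j ≤ i)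
    (x : O.cell i) :
    glueCell F G p q j (P.map j (O.tgt j h x)) (Q.map j (O.tgt j h x)) =
      B.tgt j h (glueCell F G p q i (P.map i x) (Q.map i x)) := by
  rw [P.map_tgt, Q.map_tgt]
  rcases H.cases i x with hx | hx | ⟨hx, hx'⟩
  · rw [glueCell_of_tgt hx, glueCell_of_tgt, F.map_tgt]
    rw [D.tgt_tgt, hx]
  · rw [H.glueCell_of_src hpq hx, H.glueCell_of_src hpq, G.map_tgt]
    rw [H.eq_one_left i _ hx, C.tgt_one_of_le j.zero_le h, C.src_one]
  · rcases j.eq_zero_or_pos with rfl | hj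
    · rw [H.glueCell_of_src hpq (by rw [C.src_self, hx])]
      rcases i.eq_zero_or_pos with rfl | hi
      · rw [C.tgt_self] at hx
        rw [H.glueCell_of_src hpq (by rw [C.src_self, hx]), G.map_tgt]
      · rw [H.glueCell_of_composable hpq hi hx hx', B.tgt_comp, G.map_tgt]
    · rw [H.glueCell_of_composable hpq (hj.trans_le h) hx hx',
        H.glueCell_of_composable hpq hj (by rw [C.tgt_tgt, hx]) (by rw [D.src_tgt hj, hx']),
        B.tgt_comp_of_lt hj h _ _ _ (by
          rw [B.src_tgt hj, B.tgt_tgt]; exact composable hpq hx hx')]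
      exact B.comp_congr hj (G.map_tgt _ _) (F.map_tgt _ _) _ _

lemma map_one_glueCell (H : IsGluing P Q p q) (hpq : F.map 0 p = G.map 0 q) {i j : ℕ} (h : j ≤ i)
    (x : O.cell j) :
    glueCell F G p q i (P.map i (O.one i h x)) (Q.map i (O.one i h x)) =
      B.one i h (glueCell F G p q j (P.map j x) (Q.map j x)) := by
  have hs : ∀ (E : StrictInfCat.{v}) (y : E.cell j),
      E.src 0 i.zero_le (E.one i h y) = E.src 0 j.zero_le y := fun E y => by
    rw [← E.src_src j.zero_le h, E.src_one]
  have ht : ∀ (E : StrictInfCat.{v}) (y : E.cell j),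
      E.tgt 0 i.zero_le (E.one i h y) = E.tgt 0 j.zero_le y := fun E y => by
    rw [← E.tgt_tgt j.zero_le h, E.tgt_one]
  rw [P.map_one, Q.map_one]
  rcases H.cases j x with hx | hx | ⟨hx, hx'⟩
  · rw [glueCell_of_tgt hx, glueCell_of_tgt (by rw [ht, hx]), F.map_one]
  · rw [H.glueCell_of_src hpq hx, H.glueCell_of_src hpq (by rw [hs, hx]), G.map_one]
  · rcases j.eq_zero_or_pos with rfl | hj
    · rw [C.tgt_self] at hx
      have hx'' : C.src 0 le_rfl (P.map 0 x) = p := by rw [C.src_self, hx]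
      rw [H.glueCell_of_src hpq hx'', H.glueCell_of_src hpq ((hs _ _).trans hx''), G.map_one]
    · rw [H.glueCell_of_composable hpq (hj.trans_le h) (by rw [ht, hx]) (by rw [hs, hx']),
        H.glueCell_of_composable hpq hj hx hx', B.one_comp hj h]
      exact B.comp_congr _ (G.map_one _ _) (F.map_one _ _) _
        (by rw [← G.map_one, ← F.map_one]
            exact composable hpq (by rw [ht, hx]) (by rw [hs, hx']))

/-- For `j > 0` this is the interchange law. For `j = 0`, if the composite straddles the gluing
point, then one of its factors lies on a single side, and associativity suffices. -/
lemma map_comp_glueCell (H : IsGluing P Q p q) (hpq : F.map 0 p = G.map 0 q) {i j : ℕ} (h : j < i)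
    (x y : O.cell i) (hxy : O.src j h.le x = O.tgt j h.le y)
    (hB : B.src j h.le (glueCell F G p q i (P.map i x) (Q.map i x)) =
      B.tgt j h.le (glueCell F G p q i (P.map i y) (Q.map i y))) :
    glueCell F G p q i (P.map i (O.comp j h x y hxy)) (Q.map i (O.comp j h x y hxy)) =
      B.comp j h (glueCell F G p q i (P.map i x) (Q.map i x))
        (glueCell F G p q i (P.map i y) (Q.map i y)) hB := by
  have hP : C.src j h.le (P.map i x) = C.tgt j h.le (P.map i y) := by
    rw [← P.map_src, hxy, P.map_tgt]
  have hQ : D.src j h.le (Q.map i x) = D.tgt j h.le (Q.map i y) := by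
    rw [← Q.map_src, hxy, Q.map_tgt]
  have hc := H.cases i (O.comp j h x y hxy)
  rw [P.map_comp, Q.map_comp] at hc ⊢
  rcases j.eq_zero_or_pos with rfl | hj
  · rw [D.tgt_comp, C.src_comp, C.tgt_comp, D.src_comp] at hc
    rcases hc with hx | hy | ⟨hx, hy⟩
    · have hy : D.tgt 0 i.zero_le (Q.map i y) = q := by
        rw [← hQ, H.eq_one_right i _ hx, D.src_one]
      rw [glueCell_of_tgt (by rw [D.tgt_comp, hx]), F.map_comp]
      exact B.comp_congr _ (glueCell_of_tgt hx).symm (glueCell_of_tgt hy).symm _ _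
    · have hx : C.src 0 i.zero_le (P.map i x) = p := by
        rw [hP, H.eq_one_left i _ hy, C.tgt_one]
      rw [H.glueCell_of_src hpq (by rw [C.src_comp, hy]), G.map_comp]
      exact B.comp_congr _ (H.glueCell_of_src hpq hx).symm (H.glueCell_of_src hpq hy).symm _ _
    · rw [H.glueCell_of_composable hpq h (by rw [C.tgt_comp, hx]) (by rw [D.src_comp, hy])]
      -- Here `y` lies on the `C` side: `Q y` is a unit, and `F (P y)` is reassociated into the `F`
      -- factor of `x`.
      by_cases hy' : D.tgt 0 i.zero_le (Q.map i y) = q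
      · have hx' := hQ.trans hy'
        have e₂ : D.comp 0 h (Q.map i x) (Q.map i y) hQ = Q.map i x :=
          D.comp_eq_left h _ _ q (H.eq_one_right i _ hy') hQ
        have c₁ := composable hpq hx hx'
        have c₂ : B.src 0 i.zero_le (F.map i (P.map i x)) =
            B.tgt 0 i.zero_le (F.map i (P.map i y)) := by
          rw [← F.map_src, hP, F.map_tgt]
        have c₃ : B.src 0 i.zero_le (B.comp 0 h (G.map i (Q.map i x)) (F.map i (P.map i x)) c₁) =
            B.tgt 0 i.zero_le (F.map i (P.map i y)) := by rw [B.src_comp, c₂]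
        rw [B.comp_congr h (H.glueCell_of_composable hpq h hx hx') (glueCell_of_tgt hy') hB c₃,
          B.assoc h _ _ _ c₁ c₂ c₃ (by rw [B.tgt_comp, c₁])]
        exact B.comp_congr _ (congrArg _ e₂) (F.map_comp _ _ _ _) _ _
      -- Otherwise `P y` ends at `p`, so `P x` is a unit and `x` lies on the `D` side.
      · have hx' : C.src 0 i.zero_le (P.map i x) = p := by
          rcases H.cases i y with hc | hc | hc
          · exact absurd hc hy'
          · rw [hP, H.eq_one_left i _ hc, C.tgt_one]
          · exact hP.trans hc.1
        have hyp : C.tgt 0 i.zero_le (P.map i y) = p := hP.symm.trans hx'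
        have e₂ : C.comp 0 h (P.map i x) (P.map i y) hP = P.map i y :=
          C.comp_eq_right h _ _ p (H.eq_one_left i _ hx') hP
        have c₁ := composable hpq hyp hy
        have c₂ : B.src 0 i.zero_le (G.map i (Q.map i x)) =
            B.tgt 0 i.zero_le (G.map i (Q.map i y)) := by
          rw [← G.map_src, hQ, G.map_tgt]
        have c₃ : B.src 0 i.zero_le (G.map i (Q.map i x)) =
            B.tgt 0 i.zero_le (B.comp 0 h (G.map i (Q.map i y)) (F.map i (P.map i y)) c₁) := by
          rw [B.tgt_comp, c₂]
        rw [B.comp_congr h (H.glueCell_of_src hpq hx') (H.glueCell_of_composable hpq h hyp hy) hB c₃,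
          ← B.assoc h _ _ _ c₂ c₁ (by rw [B.src_comp, c₁]) c₃]
        exact B.comp_congr _ (G.map_comp _ _ _ _) (congrArg _ e₂) _ _
  · rw [D.tgt_comp_eq_left hj.le, C.src_comp_eq_right hj.le, C.tgt_comp_eq_left hj.le,
      D.src_comp_eq_right hj.le] at hc
    rcases hc with hx | hy | ⟨hx, hy⟩
    · rw [glueCell_of_tgt (by rw [D.tgt_comp_eq_left hj.le, hx]), F.map_comp]
      exact B.comp_congr _ (glueCell_of_tgt hx).symm
        (glueCell_of_tgt ((D.tgt_eq_of_composable hj h.le hQ).symm.trans hx)).symm _ _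
    · rw [H.glueCell_of_src hpq (by rw [C.src_comp_eq_right hj.le, hy]), G.map_comp]
      exact B.comp_congr _
        (H.glueCell_of_src hpq ((C.src_eq_of_composable hj h.le hP).trans hy)).symm
        (H.glueCell_of_src hpq hy).symm _ _
    · have hx' := (D.src_eq_of_composable hj h.le hQ).trans hy
      have hy' := (C.tgt_eq_of_composable hj h.le hP).symm.trans hx
      have cx := composable hpq hx hx'
      have cy := composable hpq hy' hy
      have cQ : B.src j h.le (G.map i (Q.map i x)) = B.tgt j h.le (G.map i (Q.map i y)) := by
        rw [← G.map_src, hQ, G.map_tgt]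
      have cP : B.src j h.le (F.map i (P.map i x)) = B.tgt j h.le (F.map i (P.map i y)) := by
        rw [← F.map_src, hP, F.map_tgt]
      have hcomp : B.src j h.le (B.comp 0 (hj.trans h) _ _ cx) =
          B.tgt j h.le (B.comp 0 (hj.trans h) _ _ cy) := by
        rw [← H.glueCell_of_composable hpq (hj.trans h) hx hx',
          ← H.glueCell_of_composable hpq (hj.trans h) hy' hy, hB]
      have hcomp' : B.src 0 i.zero_le (B.comp j h _ _ cQ) =
          B.tgt 0 i.zero_le (B.comp j h _ _ cP) := by
        rw [B.src_comp_eq_right hj.le, B.tgt_comp_eq_left hj.le,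
          ← B.src_eq_of_composable hj h.le cQ, cx]
      rw [B.comp_congr h (H.glueCell_of_composable hpq (hj.trans h) hx hx')
          (H.glueCell_of_composable hpq (hj.trans h) hy' hy) hB hcomp,
        ← B.interchange hj h _ _ _ _ cQ cP cx cy hcomp' hcomp,
        H.glueCell_of_composable hpq (hj.trans h) (by rw [C.tgt_comp_eq_left hj.le, hx])
          (by rw [D.src_comp_eq_right hj.le, hy])]
      exact B.comp_congr _ (G.map_comp _ _ _ _) (F.map_comp _ _ _ _) _ _

/-- The ∞-functor obtained by gluing `F` and `G`. -/
noncomputable def glue (H : IsGluing P Q p q) (F : StrictInfFunctor C B)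
    (G : StrictInfFunctor D B) (hpq : F.map 0 p = G.map 0 q) : StrictInfFunctor O B where
  map i x := glueCell F G p q i (P.map i x) (Q.map i x)
  map_src h x := H.map_src_glueCell hpq h x
  map_tgt h x := H.map_tgt_glueCell hpq h x
  map_one h x := H.map_one_glueCell hpq h x
  map_comp h x y hxy := H.map_comp_glueCell hpq h x y hxy _

end IsGluing

end StrictInfFunctor

/-! ### Positive chains of the simplex and the weight form. -/

namespace StdSimplexChain

lemma map_map {l m n : ℕ} (ψ : Fin (m + 1) →o Fin (n + 1)) (φ : Fin (l + 1) →o Fin (m + 1))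
    (p : ℕ) (x : (Fin (p + 1) ↪o Fin (l + 1)) →₀ ℤ) :
    map ψ p (map φ p x) = map (ψ.comp φ) p x :=
  (simplexADCMap_comp ψ φ p x).symm

lemma tuple_ofStrictMono {m p : ℕ} {v : Fin (p + 1) → Fin (m + 1)} (h : StrictMono v) :
    tuple v = Finsupp.single (OrderEmbedding.ofStrictMono v h) 1 := dif_pos h

lemma tuple_mem_pos {m p : ℕ} (v : Fin (p + 1) → Fin (m + 1)) : tuple v ∈ pos m p := by
  intro w
  by_cases h : StrictMono v
  · rw [tuple_ofStrictMono h]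
    classical
    rw [Finsupp.single_apply]
    split_ifs <;> simp
  · rw [tuple_of_not_strictMono h]
    rfl

lemma aug_tuple {m : ℕ} (v : Fin (0 + 1) → Fin (m + 1)) : aug m (tuple v) = 1 := by
  rw [tuple_ofStrictMono (Subsingleton.strictMono (α := Fin 1) v)]
  simp [aug]

lemma tuple_const_of_pos {m p : ℕ} (hp : 0 < p) (a : Fin (m + 1)) :
    tuple (fun _ : Fin (p + 1) => a) = 0 :=
  tuple_of_not_strictMono fun h =>
    (h (show (0 : Fin (p + 1)) < Fin.last p from Fin.lt_def.2 hp)).false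

lemma map_tuple_const {m n : ℕ} (φ : Fin (m + 1) →o Fin (n + 1)) (p : ℕ) (a : Fin (m + 1)) :
    map φ p (tuple fun _ => a) = tuple fun _ => φ a := map_tuple φ _

/-- A chain with nonnegative coefficients on which a linear form with positive values on the basis
is nonpositive vanishes. -/
lemma eq_zero_of_linearForm_nonpos {m p : ℕ} {c : (Fin (p + 1) ↪o Fin (m + 1)) →₀ ℤ}
    (hc : c ∈ pos m p) (f : ((Fin (p + 1) ↪o Fin (m + 1)) →₀ ℤ) →+ ℤ)
    (hf : ∀ v : Fin (p + 1) ↪o Fin (m + 1), 0 < f (tuple v)) (h : f c ≤ 0) : c = 0 := by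
  have hsum : f c = c.sum fun v a => a * f (tuple v) := by
    conv_lhs => rw [← Finsupp.sum_single c]
    rw [map_finsuppSum]
    refine Finsupp.sum_congr fun v _ => ?_
    rw [← smul_eq_mul, ← map_zsmul, tuple_coe, Finsupp.smul_single, smul_eq_mul, mul_one]
  rw [hsum, Finsupp.sum] at h
  have hnn : ∀ v ∈ c.support, 0 ≤ c v * f (tuple v) := fun v _ => mul_nonneg (hc v) (hf v).le
  have h0 := (Finset.sum_eq_zero_iff_of_nonneg hnn).1 (le_antisymm h (Finset.sum_nonneg hnn))
  ext v
  by_contra hv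
  exact hv ((mul_eq_zero.1 (h0 v (Finsupp.mem_support_iff.2 hv))).resolve_right (hf v).ne')

/-- The linear form `(v 0, …, v p) ↦ v 0 + 1`. -/
noncomputable def weight (m p : ℕ) : ((Fin (p + 1) ↪o Fin (m + 1)) →₀ ℤ) →+ ℤ :=
  (Finsupp.linearCombination ℤ fun v : Fin (p + 1) ↪o Fin (m + 1) =>
    ((v 0 : ℕ) : ℤ) + 1).toAddMonoidHom

lemma weight_tuple {m p : ℕ} {v : Fin (p + 1) → Fin (m + 1)} (h : StrictMono v) :
    weight m p (tuple v) = ((v 0 : ℕ) : ℤ) + 1 := by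
  rw [tuple_ofStrictMono h]
  simp [weight]

lemma weight_tuple_const {m : ℕ} (a : Fin (m + 1)) :
    weight m 0 (tuple fun _ => a) = ((a : ℕ) : ℤ) + 1 :=
  weight_tuple (Subsingleton.strictMono (α := Fin 1) _)

/-- Every face but the zeroth begins with `v 0`. Their alternating contributions add up to `0` or to
`-(v 0 + 1)`, while the zeroth face contributes `v 1 + 1`. -/
lemma weight_d_pos {m p : ℕ} (v : Fin (p + 1 + 1) ↪o Fin (m + 1)) :
    0 < weight m p (d m p (tuple v)) := by
  have h : ∀ k : Fin (p + 2), weight m p ((-1 : ℤ) ^ (k : ℕ) • tuple (v ∘ k.succAbove)) =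
      (-1 : ℤ) ^ (k : ℕ) * (((v (k.succAbove 0) : ℕ) : ℤ) + 1) := fun k => by
    rw [map_zsmul, weight_tuple (v.strictMono.comp (Fin.strictMono_succAbove k)), smul_eq_mul]
    rfl
  have h1 : ((v 0 : ℕ) : ℤ) < ((v 1 : ℕ) : ℤ) := by
    exact_mod_cast v.strictMono (Fin.zero_lt_one)
  rw [d_tuple _ v.monotone, map_sum, Finset.sum_congr rfl fun k _ => h k, Fin.sum_univ_succ]
  have h2 : ∀ k : Fin (p + 1), (-1 : ℤ) ^ (k.succ : ℕ) *
      (((v (k.succ.succAbove 0) : ℕ) : ℤ) + 1) =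
        (-1 : ℤ) ^ (k : ℕ) * (-(((v 0 : ℕ) : ℤ) + 1)) := fun k => by
    rw [Fin.succ_succAbove_zero, Fin.val_succ, pow_succ]
    ring
  rw [Finset.sum_congr rfl fun k _ => h2 k, ← Finset.sum_mul, Fin.sum_neg_one_pow]
  simp only [Fin.val_zero, pow_zero, one_mul, Fin.succAbove_zero, Fin.succ_zero_eq_one]
  split_ifs
  · rw [zero_mul]; omega
  · rw [one_mul]; omega

/-- In particular, a positive chain of positive degree which is a cycle vanishes: this is the
loop-freeness of the simplex. -/
lemma eq_zero_of_weight_d_nonpos {m p : ℕ} {c : (Fin (p + 1 + 1) ↪o Fin (m + 1)) →₀ ℤ}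
    (hc : c ∈ pos m (p + 1)) (h : weight m p (d m p c) ≤ 0) : c = 0 :=
  eq_zero_of_linearForm_nonpos hc ((weight m p).comp (d m p)) weight_d_pos h

/-- Some coefficient is at least `1`; removing that vertex leaves a positive chain of augmentation
`0`, hence zero. -/
lemma exists_eq_tuple {m : ℕ} {c : (Fin (0 + 1) ↪o Fin (m + 1)) →₀ ℤ} (hc : c ∈ pos m 0)
    (h : aug m c = 1) : ∃ a, c = tuple fun _ => a := by
  have hne : c ≠ 0 := by
    rintro rfl
    simp at h
  obtain ⟨v, hv⟩ := Finsupp.ne_iff.1 hne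
  have hv' : 1 ≤ c v := by
    have := hc v
    have h0 : c v ≠ 0 := hv
    omega
  have htv : (tuple fun _ => v 0) = Finsupp.single v 1 := by
    rw [← tuple_coe]
    congr 1
    funext i
    rw [Subsingleton.elim (α := Fin 1) i 0]
  refine ⟨v 0, sub_eq_zero.1 (eq_zero_of_linearForm_nonpos (m := m) ?_ (aug m)
    (fun w => by rw [aug_tuple]; exact one_pos) ?_)⟩
  · intro w
    rw [htv, Finsupp.sub_apply]
    classical
    rw [Finsupp.single_apply]
    split_ifs with hw
    · subst hw
      omega
    · have := hc w
      omega
  · rw [map_sub, h, aug_tuple, sub_self]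

end StdSimplexChain

/-! ### Cells of orientals with extreme source or target. -/

namespace NuCell

open StdSimplexChain

variable {N i : ℕ}

/-- The `0`-cell of the oriental `O_N` given by the vertex `a`. -/
noncomputable def vertex (N : ℕ) (a : Fin (N + 1)) : NuCell (simplexADC N) 0 where
  ch _ _ := tuple fun _ => a
  pos _ _ := tuple_mem_pos _
  d_ch _ _ hk := absurd hk (Nat.not_lt_zero _)
  aug_ch _ := aug_tuple _
  top := rfl
  vanish _ _ hk := tuple_const_of_pos hk a

lemma bd_eq_vertex_iff {η : Fin 2} {x : NuCell (simplexADC N) i} {a : Fin (N + 1)} :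
    x.bd η 0 i.zero_le = vertex N a ↔ x.ch η 0 = tuple fun _ => a := by
  constructor
  · intro h
    exact congrFun (congrFun (congrArg NuCell.ch h) η) 0
  · intro h
    ext ε k : 3
    simp only [bd, vertex, Nat.not_lt_zero, if_false]
    split_ifs with hk
    · subst hk
      exact h
    · exact (tuple_const_of_pos (Nat.pos_of_ne_zero hk) a).symm

lemma exists_ch_zero_eq (x : NuCell (simplexADC N) i) (η : Fin 2) :
    ∃ a, x.ch η 0 = tuple fun _ => a :=
  exists_eq_tuple (x.pos η 0) (x.aug_ch η)

/-- A cell of an oriental whose target does not lie after its source is a unit. -/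
lemma eq_unit_of_weight_le {x : NuCell (simplexADC N) i}
    (h : weight N 0 (x.ch 1 0) ≤ weight N 0 (x.ch 0 0)) {η : Fin 2} {a : Fin (N + 1)}
    (ha : x.ch η 0 = tuple fun _ => a) : x = (vertex N a).unit i i.zero_le := by
  -- In degree `1` the boundary has nonpositive weight by `h`; once the entries of one degree
  -- vanish, those of the next are positive cycles.
  have hz : ∀ k ε, x.ch ε (k + 1) = 0 := by
    intro k
    induction k with
    | zero =>
      intro ε
      rcases i.eq_zero_or_pos with rfl | hi
      · exact x.vanish _ _ Nat.one_pos
      · refine eq_zero_of_weight_d_nonpos (x.pos ε 1) ?_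
        have hd : StdSimplexChain.d N 0 (x.ch ε 1) = x.ch 1 0 - x.ch 0 0 := x.d_ch ε 0 hi
        rw [hd]
        have hs : weight N 0 (x.ch 1 0 - x.ch 0 0) =
          weight N 0 (x.ch 1 0) - weight N 0 (x.ch 0 0) := map_sub (weight N 0) _ _
        rw [hs]
        omega
    | succ k ih =>
      intro ε
      rcases le_or_gt i (k + 1) with hi | hi
      · exact x.vanish _ _ (by omega)
      · refine eq_zero_of_weight_d_nonpos (x.pos ε (k + 1 + 1)) ?_
        have hd : StdSimplexChain.d N (k + 1) (x.ch ε (k + 1 + 1)) = 0 := by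
          have := x.d_ch ε (k + 1) hi
          rw [ih, ih, sub_self] at this
          exact this
        rw [hd, map_zero]
  have h01 : x.ch 0 0 = x.ch 1 0 := by
    rcases i.eq_zero_or_pos with rfl | hi
    · exact x.top
    · have := x.d_ch 0 0 hi
      rw [hz, map_zero] at this
      exact (sub_eq_zero.1 this.symm).symm
  have hη : ∀ ε, x.ch ε 0 = tuple fun _ => a := by
    have h2 : ∀ ε, x.ch ε 0 = x.ch 0 0 := by simp [Fin.forall_fin_two, h01]
    intro ε
    rw [h2 ε, ← h2 η, ha]
  ext ε k : 3
  change _ = tuple fun _ => a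
  rcases k with _ | k
  · exact hη ε
  · rw [hz]
    exact (tuple_const_of_pos k.succ_pos a).symm

/-- No vertex has smaller weight than `0`. With the dual statement for the last vertex, this
supplies the unit conditions of `IsGluing`. -/
lemma eq_unit_of_tgt_eq_zero {x : NuCell (simplexADC N) i}
    (h : x.bd 1 0 i.zero_le = vertex N 0) : x = (vertex N 0).unit i i.zero_le := by
  rw [bd_eq_vertex_iff] at h
  refine eq_unit_of_weight_le ?_ h
  obtain ⟨a, ha⟩ := x.exists_ch_zero_eq 0
  rw [h, ha, weight_tuple_const, weight_tuple_const]
  simp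

lemma eq_unit_of_src_eq_last {x : NuCell (simplexADC N) i}
    (h : x.bd 0 0 i.zero_le = vertex N (Fin.last N)) :
    x = (vertex N (Fin.last N)).unit i i.zero_le := by
  rw [bd_eq_vertex_iff] at h
  refine eq_unit_of_weight_le ?_ h
  obtain ⟨a, ha⟩ := x.exists_ch_zero_eq 1
  rw [h, ha, weight_tuple_const, weight_tuple_const, Fin.val_last]
  have := a.2
  omega

/-- A constant `tuple` is zero in positive degree, so one formula covers the vertices and the
degenerate images alike. -/
lemma map_const_ch (x : NuCell (simplexADC N) i) {M : ℕ} {φ : Fin (N + 1) →o Fin (M + 1)}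
    {a : Fin (M + 1)} (hφ : ∀ j, φ j = a) (ε : Fin 2) (k : ℕ) :
    StdSimplexChain.map φ k (x.ch ε k) = tuple fun _ => a := by
  have hv : ∀ v : Fin (k + 1) → Fin (N + 1), φ ∘ v = fun _ => a := fun v => funext fun _ => hφ _
  rcases k with _ | k
  · obtain ⟨b, hb⟩ := x.exists_ch_zero_eq ε
    rw [hb, map_tuple, hv]
  · rw [tuple_const_of_pos k.succ_pos]
    refine DFunLike.congr_fun (f := StdSimplexChain.map φ (k + 1)) (g := 0)
      (StdSimplexChain.hom_ext fun v => ?_) _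
    rw [map_tuple, hv, tuple_const_of_pos k.succ_pos]
    rfl

end NuCell

lemma orientalMap_vertex {M N : ℕ} (φ : Fin (M + 1) →o Fin (N + 1)) (a : Fin (M + 1)) :
    (orientalMap φ).map 0 (NuCell.vertex M a) = NuCell.vertex N (φ a) := by
  refine NuCell.ext ?_
  funext ε k
  exact StdSimplexChain.map_tuple_const φ k a

/-! ### Monotone maps that push vertices to `m`. -/

namespace CosliceIndex

/-- The retraction `Δ^(m+1+n) → Δ^m`, `i ↦ min i m`. -/
def initialRetr (m : ℕ) (n : SimplexCategory) : ⦋m + 1 + n.len⦌ ⟶ ⦋m⦌ :=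
  SimplexCategory.Hom.mk
    { toFun := fun i => ⟨min i.1 m, by simp only [SimplexCategory.len_mk]; omega⟩
      monotone' := fun i j h => by
        have h' : i.1 ≤ j.1 := h
        rw [Fin.le_def]; dsimp only; omega }

/-- The retraction `Δ^(m+1+n) → Δ^(1+n)` which collapses the first `m + 1` vertices. -/
def tailRetr (m : ℕ) (n : SimplexCategory) : ⦋m + 1 + n.len⦌ ⟶ ⦋0 + 1 + n.len⦌ :=
  SimplexCategory.Hom.mk
    { toFun := fun i => ⟨i.1 - m, by
        have : i.1 < m + 1 + n.len + 1 := i.2; dsimp only [SimplexCategory.len_mk]; omega⟩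
      monotone' := fun i j h => by
        have h' : i.1 ≤ j.1 := h
        rw [Fin.le_def]; dsimp only; omega }

/-- The map `Δ^(m+1+n) → Δ^(m+1+n)` which sends `m + 1 + l` to `m` if `α l = 0` and fixes all the
other vertices. -/
def collapse (m : ℕ) {n : SimplexCategory} (α : n ⟶ ⦋1⦌) : ⦋m + 1 + n.len⦌ ⟶ ⦋m + 1 + n.len⦌ :=
  SimplexCategory.Hom.mk
    { toFun := fun i => if ∃ l : Fin (n.len + 1), i.1 = m + 1 + l.1 ∧ α.toOrderHom l = 0 then
        ⟨m, by change m < m + 1 + n.len + 1; omega⟩ else i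
      monotone' := by
        intro i j hij
        have hij' : i.1 ≤ j.1 := hij
        dsimp only
        split_ifs with h1 h2 h2
        · exact le_rfl
        · obtain ⟨l, hl, -⟩ := h1
          rw [Fin.le_def]; dsimp only; omega
        · obtain ⟨l, hl, hα⟩ := h2
          rw [Fin.le_def]
          dsimp only
          rcases exists_val m i with h | ⟨l', h⟩
          · exact h
          · refine absurd ⟨l', h, ?_⟩ h1
            refine le_antisymm ?_ (Fin.zero_le _)
            rw [← hα]
            exact α.toOrderHom.monotone (by rw [Fin.le_def]; omega)
        · exact hij }

/-- The map `Δ^(m+1+n) → Δ^(m+1+n)`, `i ↦ max i m`. -/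
def tailProj (m : ℕ) (n : SimplexCategory) : ⦋m + 1 + n.len⦌ ⟶ ⦋m + 1 + n.len⦌ :=
  tailRetr m n ≫ tail m n

section

variable (m : ℕ) {n : SimplexCategory} (α : n ⟶ ⦋1⦌)

lemma initialRetr_val (i : Fin (m + 1 + n.len + 1)) :
    ((initialRetr m n).toOrderHom i).1 = min i.1 m := rfl

lemma tailRetr_val (i : Fin (m + 1 + n.len + 1)) :
    ((tailRetr m n).toOrderHom i).1 = i.1 - m := rfl

lemma tailProj_val (i : Fin (m + 1 + n.len + 1)) :
    ((tailProj m n).toOrderHom i).1 = max i.1 m := by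
  change m + (i.1 - m) = _
  omega

lemma collapse_val (i : Fin (m + 1 + n.len + 1)) :
    ((collapse m α).toOrderHom i).1 =
      if ∃ l : Fin (n.len + 1), i.1 = m + 1 + l.1 ∧ α.toOrderHom l = 0 then m else i.1 :=
  apply_ite Fin.val _ _ _

lemma collapse_val_eq_or (i : Fin (m + 1 + n.len + 1)) :
    ((collapse m α).toOrderHom i).1 = i.1 ∨
      ((collapse m α).toOrderHom i).1 = m ∧ m < i.1 := by
  rw [collapse_val]
  split_ifs with h
  · obtain ⟨l, hl, -⟩ := h
    exact Or.inr ⟨rfl, by omega⟩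
  · exact Or.inl rfl

lemma collapse_comp_initialRetr : collapse m α ≫ initialRetr m n = initialRetr m n := by
  refine hom_ext fun i => ?_
  change min ((collapse m α).toOrderHom i).1 m = min i.1 m
  rcases collapse_val_eq_or m α i with h | ⟨h, h'⟩ <;> omega

lemma tailProj_comp_tailRetr : tailProj m n ≫ tailRetr m n = tailRetr m n := by
  refine hom_ext fun i => ?_
  change ((tailProj m n).toOrderHom i).1 - m = i.1 - m
  rw [tailProj_val]
  omega

/-- The two maps push vertices to `m` from opposite sides: `collapse` moves only vertices above `m`,
and `tailProj` only those below. -/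
lemma collapse_comp_tailProj : collapse m α ≫ tailProj m n = tailProj m n ≫ collapse m α := by
  refine hom_ext fun i => ?_
  change ((tailProj m n).toOrderHom ((collapse m α).toOrderHom i)).1 =
    ((collapse m α).toOrderHom ((tailProj m n).toOrderHom i)).1
  rw [tailProj_val]
  rcases le_or_gt i.1 m with h | h
  · have h1 := collapse_val_eq_or m α i
    have h2 := collapse_val_eq_or m α ((tailProj m n).toOrderHom i)
    rw [tailProj_val] at h2
    omega
  · have : (tailProj m n).toOrderHom i = i := Fin.ext (by rw [tailProj_val]; omega)
    rw [this]
    have h1 := collapse_val_eq_or m α i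
    omega

lemma initialIncl_comp_collapse : initialIncl m n ≫ collapse m α = initialIncl m n := by
  refine hom_ext fun i => ?_
  change ((collapse m α).toOrderHom ((initialIncl m n).toOrderHom i)).1 = i.1
  have h : ((initialIncl m n).toOrderHom i).1 = i.1 := rfl
  have h1 := collapse_val_eq_or m α ((initialIncl m n).toOrderHom i)
  have := i.2
  simp only [SimplexCategory.len_mk] at this
  omega

lemma finalIncl_comp_tailProj : finalIncl m n ≫ tailProj m n = finalIncl m n := by
  refine hom_ext fun i => ?_
  change m + (m + 1 + i.1 - m) = m + 1 + i.1
  omega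

lemma tail_comp_tailRetr : tail m n ≫ tailRetr m n = 𝟙 _ := by
  refine hom_ext fun i => ?_
  change m + i.1 - m = i.1
  omega

lemma initialIncl_comp_initialRetr : initialIncl m n ≫ initialRetr m n = 𝟙 _ := by
  refine hom_ext fun i => ?_
  change min i.1 m = i.1
  have := i.2
  simp only [SimplexCategory.len_mk] at this
  omega

lemma shift_comp_tailRetr {n' : SimplexCategory} (ψ : n' ⟶ n) :
    shift m ψ ≫ tailRetr m n = tailRetr m n' ≫ shift 0 ψ := by
  refine hom_ext fun i => ?_
  change ((shift m ψ).toOrderHom i).1 - m = ((shift 0 ψ).toOrderHom ((tailRetr m n').toOrderHom i)).1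
  have ht := tailRetr_val m i
  rcases exists_val m i with h | ⟨l, h⟩
  · rw [shift_val_of_le m ψ i h, shift_val_of_le 0 ψ _ (by omega), ht]
  · rw [shift_val m ψ i l h, shift_val 0 ψ _ l (by omega)]
    omega

lemma shift_comp_tailProj {n' : SimplexCategory} (ψ : n' ⟶ n) :
    shift m ψ ≫ tailProj m n = tailProj m n' ≫ shift m ψ := by
  rw [tailProj, tailProj, ← Category.assoc, shift_comp_tailRetr, Category.assoc, ← tail_shift,
    Category.assoc]

/-- The parameter changes from `α` to `ψ ≫ α`, as for simplices of `Δ[1]`; this makes the homotopy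
simplicial. -/
lemma shift_comp_collapse {n' : SimplexCategory} (ψ : n' ⟶ n) :
    shift m ψ ≫ collapse m α = collapse m (ψ ≫ α) ≫ shift m ψ := by
  refine hom_ext fun i => ?_
  change ((collapse m α).toOrderHom ((shift m ψ).toOrderHom i)).1 =
    ((shift m ψ).toOrderHom ((collapse m (ψ ≫ α)).toOrderHom i)).1
  rcases exists_val m i with h | ⟨l, h⟩
  · have h1 := shift_val_of_le m ψ i h
    have h2 := collapse_val_eq_or m (ψ ≫ α) i
    have h3 := collapse_val_eq_or m α ((shift m ψ).toOrderHom i)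
    rw [shift_val_of_le m ψ ((collapse m (ψ ≫ α)).toOrderHom i) (by omega)]
    omega
  · have h1 := shift_val m ψ i l h
    have h2 : ((collapse m (ψ ≫ α)).toOrderHom i).1 =
        if α.toOrderHom (ψ.toOrderHom l) = 0 then m else i.1 := by
      rw [collapse_val]
      congr 1
      refine propext ⟨?_, fun hα => ⟨l, h, hα⟩⟩
      rintro ⟨l', hl', hα⟩
      obtain rfl : l = l' := Fin.ext (by omega)
      exact hα
    have h3 : ((collapse m α).toOrderHom ((shift m ψ).toOrderHom i)).1 =
        if α.toOrderHom (ψ.toOrderHom l) = 0 then m else ((shift m ψ).toOrderHom i).1 := by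
      rw [collapse_val]
      congr 1
      refine propext ⟨?_, fun hα => ⟨_, h1, hα⟩⟩
      rintro ⟨l', hl', hα⟩
      obtain rfl : ψ.toOrderHom l = l' := Fin.ext (by omega)
      exact hα
    split_ifs at h2 h3
    · rw [h3, shift_val_of_le m ψ _ (by omega), h2]
    · rw [h3]
      congr 2
      exact Fin.ext h2.symm

lemma collapse_of_eq_one (hα : ∀ l, α.toOrderHom l = 1) : collapse m α = 𝟙 _ := by
  refine hom_ext fun i => ?_
  refine (collapse_val m α i).trans (if_neg ?_)
  rintro ⟨l, -, hl⟩
  rw [hα] at hl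
  exact one_ne_zero hl

lemma collapse_of_eq_zero (hα : ∀ l, α.toOrderHom l = 0) :
    collapse m α = initialRetr m n ≫ initialIncl m n := by
  refine hom_ext fun i => ?_
  rw [collapse_val]
  change _ = min i.1 m
  rcases exists_val m i with h | ⟨l, h⟩
  · rw [if_neg (by rintro ⟨l, hl, -⟩; omega)]
    omega
  · rw [if_pos ⟨l, h, hα l⟩]
    omega

end

end CosliceIndex

namespace StrictInfFunctor.IsGluing

variable {O : StrictInfCat.{w}} {C D : StrictInfCat.{v}} {B : StrictInfCat.{u}}
  {P : StrictInfFunctor O C} {Q : StrictInfFunctor O D} {p : C.cell 0} {q : D.cell 0}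

/-- Allows an identity between ∞-endofunctors of the oriental, such as `deform_of_eq_zero`, to be
transported to an arbitrary target. -/
lemma comp_glue {B' : StrictInfCat.{u}} {B : StrictInfCat.{v}} (H : IsGluing P Q p q)
    {F : StrictInfFunctor C B} {G : StrictInfFunctor D B} (hpq : F.map 0 p = G.map 0 q)
    (K : StrictInfFunctor B B') (hpq' : (K.comp F).map 0 p = (K.comp G).map 0 q) :
    K.comp (H.glue F G hpq) = H.glue (K.comp F) (K.comp G) hpq' := by
  apply StrictInfFunctor.ext
  funext i x
  change K.map i (glueCell F G p q i (P.map i x) (Q.map i x)) =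
    glueCell (K.comp F) (K.comp G) p q i (P.map i x) (Q.map i x)
  rcases H.cases i x with hx | hx | ⟨hx, hx'⟩
  · rw [glueCell_of_tgt hx, glueCell_of_tgt hx]
    rfl
  · rw [H.glueCell_of_src hpq hx, H.glueCell_of_src hpq' hx]
    rfl
  · rcases i.eq_zero_or_pos with rfl | hi
    · have hs : C.src 0 le_rfl (P.map 0 x) = p := by rw [C.src_self, ← hx, C.tgt_self]
      rw [H.glueCell_of_src hpq hs, H.glueCell_of_src hpq' hs]
      rfl
    · rw [H.glueCell_of_composable hpq hi hx hx', H.glueCell_of_composable hpq' hi hx hx',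
        K.map_comp]
      rfl

end StrictInfFunctor.IsGluing

/-! ### The deformation `φ + μ - μφ` of the oriental. -/

namespace StdSimplexChain

lemma map_mem_pos_of_tuple {m n p : ℕ}
    (f : ((Fin (p + 1) ↪o Fin (m + 1)) →₀ ℤ) →+ ((Fin (p + 1) ↪o Fin (n + 1)) →₀ ℤ))
    (hf : ∀ v : Fin (p + 1) ↪o Fin (m + 1), f (tuple v) ∈ pos n p)
    {c : (Fin (p + 1) ↪o Fin (m + 1)) →₀ ℤ} (hc : c ∈ pos m p) : f c ∈ pos n p := by
  have hsum : f c = c.sum fun v a => a • f (tuple v) := by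
    conv_lhs => rw [← Finsupp.sum_single c]
    rw [map_finsuppSum]
    refine Finsupp.sum_congr fun v _ => ?_
    rw [← map_zsmul, tuple_coe, Finsupp.smul_single, smul_eq_mul, mul_one]
  intro w
  rw [hsum, Finsupp.sum_apply]
  refine Finset.sum_nonneg fun v _ => ?_
  dsimp only
  rw [Finsupp.smul_apply, smul_eq_mul]
  exact mul_nonneg (hc v) (hf v w)

end StdSimplexChain

namespace CosliceIndex

section

variable (m : ℕ) {n : SimplexCategory} (α : n ⟶ ⦋1⦌)

/-- The chain endomorphism `φ + μ - μ φ` of `c Δ^(m+1+n)`, where `φ` is induced by `collapse m α`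
and `μ` by `tailProj m n`. -/
noncomputable def blendChain (p : ℕ) :
    ((Fin (p + 1) ↪o Fin (m + 1 + n.len + 1)) →₀ ℤ) →+
      ((Fin (p + 1) ↪o Fin (m + 1 + n.len + 1)) →₀ ℤ) :=
  StdSimplexChain.map (collapse m α).toOrderHom p + StdSimplexChain.map (tailProj m n).toOrderHom p -
    StdSimplexChain.map (collapse m α ≫ tailProj m n).toOrderHom p

lemma blendChain_apply (p : ℕ) (x : (Fin (p + 1) ↪o Fin (m + 1 + n.len + 1)) →₀ ℤ) :
    blendChain m α p x = StdSimplexChain.map (collapse m α).toOrderHom p x +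
      StdSimplexChain.map (tailProj m n).toOrderHom p x -
        StdSimplexChain.map (collapse m α ≫ tailProj m n).toOrderHom p x := rfl

/-- If `μφ(v)` is strictly increasing, its entries after the first exceed `m`, so `φ` and `μ` both
fix those entries of `v`. Only `v 0` matters: either `φ` fixes it, or `φ` sends it to `m`, which `μ`
fixes. -/
lemma collapse_comp_tailProj_eq_or {p : ℕ} (v : Fin (p + 1) → Fin (m + 1 + n.len + 1))
    (h : StrictMono ((collapse m α ≫ tailProj m n).toOrderHom ∘ v)) :
    (collapse m α ≫ tailProj m n).toOrderHom ∘ v = (collapse m α).toOrderHom ∘ v ∨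
      (collapse m α ≫ tailProj m n).toOrderHom ∘ v = (tailProj m n).toOrderHom ∘ v := by
  have hval : ∀ i, ((collapse m α ≫ tailProj m n).toOrderHom i).1 =
      max ((collapse m α).toOrderHom i).1 m := fun i => tailProj_val m _
  have hpos : ∀ k, k ≠ 0 → m < ((collapse m α).toOrderHom (v k)).1 := fun k hk => by
    have h0 : ((collapse m α ≫ tailProj m n).toOrderHom (v 0)).1 <
        ((collapse m α ≫ tailProj m n).toOrderHom (v k)).1 := h (Fin.pos_iff_ne_zero.2 hk)
    rw [hval, hval] at h0
    omega
  rcases collapse_val_eq_or m α (v 0) with h0 | ⟨h0, h0'⟩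
  · right
    funext k
    apply Fin.ext
    change ((collapse m α ≫ tailProj m n).toOrderHom (v k)).1 = ((tailProj m n).toOrderHom (v k)).1
    rw [hval, tailProj_val]
    by_cases hk : k = 0
    · rw [hk, h0]
    · have h1 := hpos k hk
      have h2 := collapse_val_eq_or m α (v k)
      omega
  · left
    funext k
    apply Fin.ext
    change ((collapse m α ≫ tailProj m n).toOrderHom (v k)).1 = ((collapse m α).toOrderHom (v k)).1
    rw [hval]
    by_cases hk : k = 0
    · rw [hk, h0, max_self]
    · have h1 := hpos k hk
      omega

open StdSimplexChain in
-- On each basis element the negative term is zero or cancels one of the positive terms.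
lemma blendChain_mem_pos (p : ℕ) {x : (Fin (p + 1) ↪o Fin (m + 1 + n.len + 1)) →₀ ℤ}
    (hx : x ∈ pos (m + 1 + n.len) p) : blendChain m α p x ∈ pos (m + 1 + n.len) p := by
  refine map_mem_pos_of_tuple _ (fun v => ?_) hx
  rw [blendChain_apply, map_tuple, map_tuple, map_tuple]
  by_cases h : StrictMono ((collapse m α ≫ tailProj m n).toOrderHom ∘ v)
  · rcases collapse_comp_tailProj_eq_or m α v h with h' | h'
    · rw [h', add_sub_cancel_left]
      exact tuple_mem_pos _
    · rw [h', add_sub_cancel_right]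
      exact tuple_mem_pos _
  · rw [tuple_of_not_strictMono h, sub_zero]
    exact add_mem (tuple_mem_pos _) (tuple_mem_pos _)

lemma blendChain_d (p : ℕ) (x : (Fin (p + 1 + 1) ↪o Fin (m + 1 + n.len + 1)) →₀ ℤ) :
    blendChain m α p (StdSimplexChain.d (m + 1 + n.len) p x) =
      StdSimplexChain.d (m + 1 + n.len) p (blendChain m α (p + 1) x) := by
  have h : ∀ f : ⦋m + 1 + n.len⦌ ⟶ ⦋m + 1 + n.len⦌,
      StdSimplexChain.map f.toOrderHom p (StdSimplexChain.d (m + 1 + n.len) p x) =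
        StdSimplexChain.d (m + 1 + n.len) p (StdSimplexChain.map f.toOrderHom (p + 1) x) :=
    fun f => (simplexADCMap f.toOrderHom).map_d p x
  rw [blendChain_apply, blendChain_apply, map_sub, map_add]
  exact congrArg₂ _ (congrArg₂ _ (h _) (h _)) (h _)

lemma aug_blendChain (x : (Fin (0 + 1) ↪o Fin (m + 1 + n.len + 1)) →₀ ℤ) :
    StdSimplexChain.aug (m + 1 + n.len) (blendChain m α 0 x) =
      StdSimplexChain.aug (m + 1 + n.len) x := by
  have h : ∀ f : ⦋m + 1 + n.len⦌ ⟶ ⦋m + 1 + n.len⦌,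
      StdSimplexChain.aug (m + 1 + n.len) (StdSimplexChain.map f.toOrderHom 0 x) =
        StdSimplexChain.aug (m + 1 + n.len) x :=
    fun f => (simplexADCMap f.toOrderHom).aug_map x
  rw [blendChain_apply, map_sub, map_add]
  exact (congrArg₂ _ (congrArg₂ _ (h _) (h _)) (h _)).trans (add_sub_cancel_right _ _)

/-- The endomorphism of `c Δ^(m+1+n)` which replaces the edges `(i, m + 1 + l)`, for `i ≤ m` and
`α l = 0`, by the paths `(i, m) + (m, m + 1 + l)`. -/
noncomputable def blend : ADCHom (simplexADC (m + 1 + n.len)) (simplexADC (m + 1 + n.len)) where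
  map := blendChain m α
  map_d := blendChain_d m α
  aug_map := aug_blendChain m α
  map_pos p _ hx := blendChain_mem_pos m α p hx

/-- The ∞-endofunctor of the oriental `O_(m+1+n)` induced by `blend m α`. -/
noncomputable def deform :
    StrictInfFunctor (oriental (m + 1 + n.len)) (oriental (m + 1 + n.len)) :=
  ADC.nuMap (blend m α)

lemma map_blendChain {b : SimplexCategory} (f : ⦋m + 1 + n.len⦌ ⟶ b) (p : ℕ)
    (x : (Fin (p + 1) ↪o Fin (m + 1 + n.len + 1)) →₀ ℤ) :
    StdSimplexChain.map f.toOrderHom p (blendChain m α p x) =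
      StdSimplexChain.map (collapse m α ≫ f).toOrderHom p x +
        StdSimplexChain.map (tailProj m n ≫ f).toOrderHom p x -
          StdSimplexChain.map (collapse m α ≫ tailProj m n ≫ f).toOrderHom p x := by
  rw [blendChain_apply, map_sub, map_add]
  exact congrArg₂ _ (congrArg₂ _ (StdSimplexChain.map_map _ _ _ _)
    (StdSimplexChain.map_map _ _ _ _)) (StdSimplexChain.map_map _ _ _ _)

lemma blendChain_map {a : SimplexCategory} (f : a ⟶ ⦋m + 1 + n.len⦌) (p : ℕ)
    (x : (Fin (p + 1) ↪o Fin (a.len + 1)) →₀ ℤ) :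
    blendChain m α p (StdSimplexChain.map f.toOrderHom p x) =
      StdSimplexChain.map (f ≫ collapse m α).toOrderHom p x +
        StdSimplexChain.map (f ≫ tailProj m n).toOrderHom p x -
          StdSimplexChain.map (f ≫ collapse m α ≫ tailProj m n).toOrderHom p x := by
  rw [blendChain_apply]
  exact congrArg₂ _ (congrArg₂ _ (StdSimplexChain.map_map _ _ _ _)
    (StdSimplexChain.map_map _ _ _ _)) (StdSimplexChain.map_map _ _ _ _)

/-- In `fφ + fμ - fμφ`, if `fμ = f` the last two terms become `fμ = f` and `-fφ`; if `fφ = f`,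
commutation turns `fμφ` into `fμ`. Either way only `f` remains. -/
lemma orientalMap_comp_deform {b : SimplexCategory} (f : ⦋m + 1 + n.len⦌ ⟶ b)
    (hf : collapse m α ≫ f = f ∨ tailProj m n ≫ f = f) :
    (orientalMap f.toOrderHom).comp (deform m α) = orientalMap f.toOrderHom := by
  apply StrictInfFunctor.ext
  funext i x
  refine NuCell.ext ?_
  funext ε k
  refine (map_blendChain m α f k _).trans ?_
  rcases hf with hf | hf
  · rw [← Category.assoc, collapse_comp_tailProj, Category.assoc, hf]
    exact add_sub_cancel_right _ _
  · rw [hf]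
    exact add_sub_cancel_left _ _

lemma deform_comp_orientalMap {a : SimplexCategory} (f : a ⟶ ⦋m + 1 + n.len⦌)
    (hf : f ≫ collapse m α = f ∨ f ≫ tailProj m n = f) :
    (deform m α).comp (orientalMap f.toOrderHom) = orientalMap f.toOrderHom := by
  apply StrictInfFunctor.ext
  funext i x
  refine NuCell.ext ?_
  funext ε k
  refine (blendChain_map m α f k _).trans ?_
  rcases hf with hf | hf
  · rw [← Category.assoc, hf]
    exact add_sub_cancel_right _ _
  · rw [collapse_comp_tailProj, ← Category.assoc, hf]
    exact add_sub_cancel_left _ _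

lemma deform_comp_shift {n' : SimplexCategory} (ψ : n' ⟶ n) :
    (deform m α).comp (orientalMap (shift m ψ).toOrderHom) =
      (orientalMap (shift m ψ).toOrderHom).comp (deform m (ψ ≫ α)) := by
  apply StrictInfFunctor.ext
  funext i x
  refine NuCell.ext ?_
  funext ε k
  refine (blendChain_map m α (shift m ψ) k _).trans
    (Eq.trans ?_ (map_blendChain m (ψ ≫ α) (shift m ψ) k _).symm)
  rw [← Category.assoc, shift_comp_collapse, Category.assoc, shift_comp_tailProj]

lemma deform_of_eq_one (hα : ∀ l, α.toOrderHom l = 1) :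
    deform m α = orientalMap (OrderHom.id : Fin (m + 1 + n.len + 1) →o _) := by
  apply StrictInfFunctor.ext
  funext i x
  refine NuCell.ext ?_
  funext ε k
  refine (blendChain_apply m α k _).trans ?_
  rw [collapse_of_eq_one m α hα, Category.id_comp]
  exact add_sub_cancel_right _ _

end

lemma orientalMap_comp {a b c : SimplexCategory} (f : a ⟶ b) (g : b ⟶ c) :
    (orientalMap g.toOrderHom).comp (orientalMap f.toOrderHom) =
      orientalMap (f ≫ g).toOrderHom := by
  apply StrictInfFunctor.ext
  funext i x
  refine NuCell.ext ?_
  funext ε k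
  exact StdSimplexChain.map_map _ _ _ _

lemma comp_orientalMap_id {N : ℕ} {B : StrictInfCat.{u}} (K : StrictInfFunctor (oriental N) B) :
    K.comp (orientalMap (OrderHom.id : Fin (N + 1) →o _)) = K := by
  apply StrictInfFunctor.ext
  funext i x
  refine congrArg (K.map i) (NuCell.ext ?_)
  funext ε k
  exact simplexADCMap_id _ _ _

/-! ### Extending ∞-functors from the two faces to `O_(m+1+n)`. -/

section

open StdSimplexChain

variable (m : ℕ) (n : SimplexCategory)

lemma isGluing : StrictInfFunctor.IsGluing (O := oriental (m + 1 + n.len)) (C := oriental m)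
    (D := oriental (0 + 1 + n.len)) (orientalMap (initialRetr m n).toOrderHom)
    (orientalMap (tailRetr m n).toOrderHom) (NuCell.vertex m (Fin.last m))
    (NuCell.vertex (0 + 1 + n.len) 0) where
  eq_one_left _ _ h := NuCell.eq_unit_of_src_eq_last h
  eq_one_right _ _ h := NuCell.eq_unit_of_tgt_eq_zero h
  cases i x := by
    have hP : ∀ η a j, x.ch η 0 = tuple (fun _ => a) → (initialRetr m n).toOrderHom a = j →
        NuCell.bd η 0 i.zero_le ((orientalMap (initialRetr m n).toOrderHom).map i x) =
          NuCell.vertex m j := by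
      rintro η a j ha rfl
      refine NuCell.bd_eq_vertex_iff.2 ?_
      exact (congrArg (StdSimplexChain.map (initialRetr m n).toOrderHom 0) ha).trans
        (map_tuple_const _ _ _)
    have hQ : ∀ η a j, x.ch η 0 = tuple (fun _ => a) → (tailRetr m n).toOrderHom a = j →
        NuCell.bd η 0 i.zero_le ((orientalMap (tailRetr m n).toOrderHom).map i x) =
          NuCell.vertex (0 + 1 + n.len) j := by
      rintro η a j ha rfl
      refine NuCell.bd_eq_vertex_iff.2 ?_
      exact (congrArg (StdSimplexChain.map (tailRetr m n).toOrderHom 0) ha).trans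
        (map_tuple_const _ _ _)
    obtain ⟨a, ha⟩ := NuCell.exists_ch_zero_eq x 0
    obtain ⟨c, hc⟩ := NuCell.exists_ch_zero_eq x 1
    have hP' : ∀ a : Fin (m + 1 + n.len + 1), m ≤ a.1 →
        (initialRetr m n).toOrderHom a = Fin.last m := fun a h =>
      Fin.ext ((initialRetr_val m a).trans (min_eq_right h))
    have hQ' : ∀ a : Fin (m + 1 + n.len + 1), a.1 ≤ m →
        (tailRetr m n).toOrderHom a = (0 : Fin (0 + 1 + n.len + 1)) := fun a h =>
      Fin.ext ((tailRetr_val m a).trans (Nat.sub_eq_zero_of_le h))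
    -- With source vertex `a` and target vertex `c`, the three cases are `c ≤ m`, `m ≤ a` and `a ≤ m
    -- ≤ c`.
    rcases le_total c.1 m with h | h
    · exact Or.inl (hQ 1 c 0 hc (hQ' c h))
    · rcases le_total m a.1 with h' | h'
      · exact Or.inr (Or.inl (hP 0 a _ ha (hP' a h')))
      · exact Or.inr (Or.inr ⟨hP 1 c _ hc (hP' c h), hQ 0 a _ ha (hQ' a h')⟩)

variable {m n} {B : StrictInfCat.{u}}

/-- The extension to the oriental `O_(m+1+n)` of ∞-functors defined on its faces `0, …, m` and
`m, …, m + 1 + n`. -/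
noncomputable def extend (b : StrictInfFunctor (oriental m) B)
    (z : StrictInfFunctor (oriental (0 + 1 + n.len)) B)
    (h : b.map 0 (NuCell.vertex m (Fin.last m)) = z.map 0 (NuCell.vertex _ 0)) :
    StrictInfFunctor (oriental (m + 1 + n.len)) B :=
  (isGluing m n).glue b z h

section

variable (b : StrictInfFunctor (oriental m) B)
  (z : StrictInfFunctor (oriental (0 + 1 + n.len)) B)
  (h : b.map 0 (NuCell.vertex m (Fin.last m)) = z.map 0 (NuCell.vertex _ 0))

/-- On this face the projection `tailRetr` is constant, so gluing takes its first branch; on the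
tail it is `initialRetr` that is constant. -/
lemma extend_comp_initialIncl :
    (extend b z h).comp (orientalMap (initialIncl m n).toOrderHom) = b := by
  have e : (orientalMap (initialRetr m n).toOrderHom).comp
      (orientalMap (initialIncl m n).toOrderHom) = orientalMap (𝟙 ⦋m⦌ : ⦋m⦌ ⟶ ⦋m⦌).toOrderHom := by
    rw [orientalMap_comp, initialIncl_comp_initialRetr]
  refine Eq.trans ?_ (comp_orientalMap_id b)
  apply StrictInfFunctor.ext
  funext i x
  refine (StrictInfFunctor.IsGluing.glueCell_of_tgt ?_).trans
    (congrArg (fun K => b.map i (StrictInfFunctor.map K i x)) e)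
  refine NuCell.bd_eq_vertex_iff.2 ?_
  refine (map_map _ _ _ _).trans (NuCell.map_const_ch x (fun j => ?_) _ _)
  have := j.2
  refine Fin.ext ?_
  change j.1 - m = 0
  simp only [SimplexCategory.len_mk] at this
  omega

lemma extend_comp_tail : (extend b z h).comp (orientalMap (tail m n).toOrderHom) = z := by
  have e : (orientalMap (tailRetr m n).toOrderHom).comp (orientalMap (tail m n).toOrderHom) =
      orientalMap (𝟙 ⦋0 + 1 + n.len⦌ : ⦋0 + 1 + n.len⦌ ⟶ _).toOrderHom := by
    rw [orientalMap_comp, tail_comp_tailRetr]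
  refine Eq.trans ?_ (comp_orientalMap_id z)
  apply StrictInfFunctor.ext
  funext i x
  refine ((isGluing m n).glueCell_of_src h ?_).trans
    (congrArg (fun K => z.map i (StrictInfFunctor.map K i x)) e)
  refine NuCell.bd_eq_vertex_iff.2 ?_
  refine (map_map _ _ _ _).trans (NuCell.map_const_ch x (fun j => ?_) _ _)
  refine Fin.ext ?_
  change min (m + j.1) m = m
  omega

/-- A glued ∞-functor sees a cell only through its two projections, and both absorb `deform`. Hence
the homotopy is constant on the image of the section. -/
lemma extend_comp_deform (α : n ⟶ ⦋1⦌) : (extend b z h).comp (deform m α) = extend b z h := by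
  apply StrictInfFunctor.ext
  funext i x
  have hP := congrArg (fun K => StrictInfFunctor.map K i x)
    (orientalMap_comp_deform m α (initialRetr m n) (Or.inl (collapse_comp_initialRetr m α)))
  have hQ := congrArg (fun K => StrictInfFunctor.map K i x)
    (orientalMap_comp_deform m α (tailRetr m n) (Or.inr (tailProj_comp_tailRetr m)))
  exact congrArg₂ (StrictInfFunctor.glueCell b z (NuCell.vertex m (Fin.last m))
    (NuCell.vertex _ 0) i) hP hQ

end

lemma orientalMap_vertex_last_eq :
    (orientalMap (initialIncl m n).toOrderHom).map 0 (NuCell.vertex m (Fin.last m)) =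
      (orientalMap (tail m n).toOrderHom).map 0 (NuCell.vertex (0 + 1 + n.len) 0) :=
  (orientalMap_vertex (initialIncl m n).toOrderHom (Fin.last m)).trans
    (orientalMap_vertex (tail m n).toOrderHom 0).symm

/-- Here `φ` and `μ` are the projections onto the two faces followed by the inclusions, and `μφ` is
constant at `m`. The entries of the deformed cell are thus those of the two face parts added, minus
the vertex `m`. If one part is the unit on `m`, it cancels. -/
lemma deform_of_eq_zero (α : n ⟶ ⦋1⦌) (hα : ∀ l, α.toOrderHom l = 0) :
    deform m α = extend (orientalMap (initialIncl m n).toOrderHom)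
      (orientalMap (tail m n).toOrderHom) orientalMap_vertex_last_eq := by
  apply StrictInfFunctor.ext
  funext i x
  have H := isGluing m n
  have hv := orientalMap_vertex_last_eq (m := m) (n := n)
  let a : Fin (m + 1 + n.len + 1) := (initialIncl m n).toOrderHom (Fin.last m)
  have hch : ∀ ε k, NuCell.ch (K := simplexADC (m + 1 + n.len)) ((deform m α).map i x) ε k =
      (NuCell.ch (K := simplexADC (m + 1 + n.len))
        ((orientalMap (initialIncl m n).toOrderHom).map i
          ((orientalMap (initialRetr m n).toOrderHom).map i x)) ε k +
        NuCell.ch (K := simplexADC (m + 1 + n.len))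
          ((orientalMap (tail m n).toOrderHom).map i
          ((orientalMap (tailRetr m n).toOrderHom).map i x)) ε k) -
            NuCell.ch (NuCell.vertex (m + 1 + n.len) a) ε k := by
    intro ε k
    refine (blendChain_apply m α k _).trans ?_
    rw [collapse_of_eq_zero m α hα]
    refine congrArg₂ _ (congrArg₂ _ (map_map _ _ _ _).symm (map_map _ _ _ _).symm)
      (NuCell.map_const_ch x (fun j => Fin.ext ?_) ε k)
    change m + (min j.1 m - m) = m
    omega
  have hF : ∀ ε k, NuCell.ch ((orientalMap (initialRetr m n).toOrderHom).map i x) ε k =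
      tuple (fun _ => Fin.last m) → NuCell.ch (K := simplexADC (m + 1 + n.len))
        ((orientalMap (initialIncl m n).toOrderHom).map i
          ((orientalMap (initialRetr m n).toOrderHom).map i x)) ε k = tuple fun _ => a :=
    fun ε k h => (congrArg (StdSimplexChain.map (initialIncl m n).toOrderHom k) h).trans
      (map_tuple_const _ _ _)
  have hG : ∀ ε k, NuCell.ch ((orientalMap (tailRetr m n).toOrderHom).map i x) ε k =
      tuple (fun _ => (0 : Fin (0 + 1 + n.len + 1))) →
        NuCell.ch (K := simplexADC (m + 1 + n.len))
          ((orientalMap (tail m n).toOrderHom).map i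
          ((orientalMap (tailRetr m n).toOrderHom).map i x)) ε k = tuple fun _ => a :=
    fun ε k h => (congrArg (StdSimplexChain.map (tail m n).toOrderHom k) h).trans
      (map_tuple_const _ _ _)
  rcases H.cases i x with hx | hx | ⟨hx, hx'⟩
  · refine Eq.trans ?_ (StrictInfFunctor.IsGluing.glueCell_of_tgt hx).symm
    refine NuCell.ext ?_
    funext ε k
    rw [hch, hG ε k (congrArg (fun y => NuCell.ch y ε k) (H.eq_one_right i _ hx))]
    exact add_sub_cancel_right _ _
  · refine Eq.trans ?_ (H.glueCell_of_src hv hx).symm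
    refine NuCell.ext ?_
    funext ε k
    rw [hch, hF ε k (congrArg (fun y => NuCell.ch y ε k) (H.eq_one_left i _ hx))]
    exact add_sub_cancel_left _ _
  · rcases i.eq_zero_or_pos with rfl | hi
    · have hs : (oriental m).src 0 le_rfl
          ((orientalMap (initialRetr m n).toOrderHom).map 0 x) = NuCell.vertex m (Fin.last m) := by
        rw [(oriental m).tgt_self] at hx
        rw [(oriental m).src_self, hx]
      refine Eq.trans ?_ (H.glueCell_of_src hv hs).symm
      refine NuCell.ext ?_
      funext ε k
      rw [hch, hF ε k (congrArg (fun y => NuCell.ch y ε k) (H.eq_one_left 0 _ hs))]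
      exact add_sub_cancel_left _ _
    · refine Eq.trans ?_ (H.glueCell_of_composable hv hi hx hx').symm
      refine NuCell.ext ?_
      funext ε k
      rw [hch]
      -- Comparison with the table of `*_0`: in degree `0` the vertex `m` cancels the source of the
      -- `G` part in row `0` and the target of the `F` part in row `1`; in higher degrees it is zero
      -- and the sum remains.
      refine Eq.trans ?_ (if_congr (Nat.le_zero (i := k)) rfl rfl).symm
      split_ifs with hk hε
      · subst hk hε
        rw [hG 0 0 (NuCell.bd_eq_vertex_iff.1 hx')]
        exact add_sub_cancel_right _ _
      · obtain rfl : ε = 1 := by omega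
        subst hk
        rw [hF 1 0 (NuCell.bd_eq_vertex_iff.1 hx)]
        exact add_sub_cancel_left _ _
      · rw [(NuCell.vertex (m + 1 + n.len) a).vanish ε k (Nat.pos_of_ne_zero hk)]
        exact (sub_zero _).trans (add_comm _ _)

/-- The morphism `n ⟶ ⦋1⦌` which is constant with value `0`. -/
def constZero (n : SimplexCategory) : n ⟶ ⦋1⦌ := SimplexCategory.const n ⦋1⦌ 0

lemma comp_constZero {n n' : SimplexCategory} (ψ : n' ⟶ n) : ψ ≫ constZero n = constZero n' := rfl

/-- Characterises glued ∞-functors by their two faces and invariance under `deform`; naturality of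
the section follows from it. -/
lemma eq_extend {K : StrictInfFunctor (oriental (m + 1 + n.len)) B}
    {b : StrictInfFunctor (oriental m) B} {z : StrictInfFunctor (oriental (0 + 1 + n.len)) B}
    (h : b.map 0 (NuCell.vertex m (Fin.last m)) = z.map 0 (NuCell.vertex _ 0))
    (hb : K.comp (orientalMap (initialIncl m n).toOrderHom) = b)
    (hz : K.comp (orientalMap (tail m n).toOrderHom) = z)
    (hK : K.comp (deform m (constZero n)) = K) : K = extend b z h := by
  subst hb hz
  rw [deform_of_eq_zero (constZero n) fun _ => rfl] at hK
  exact hK.symm.trans ((isGluing m n).comp_glue _ K h)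

lemma comp_deform_eq_extend (α : n ⟶ ⦋1⦌) (hα : ∀ l, α.toOrderHom l = 0)
    (K : StrictInfFunctor (oriental (m + 1 + n.len)) B) {b : StrictInfFunctor (oriental m) B}
    {z : StrictInfFunctor (oriental (0 + 1 + n.len)) B}
    (h : b.map 0 (NuCell.vertex m (Fin.last m)) = z.map 0 (NuCell.vertex _ 0))
    (hb : K.comp (orientalMap (initialIncl m n).toOrderHom) = b)
    (hz : K.comp (orientalMap (tail m n).toOrderHom) = z) :
    K.comp (deform m α) = extend b z h := by
  subst hb hz
  rw [deform_of_eq_zero α hα]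
  exact (isGluing m n).comp_glue _ K h

lemma extend_comp_shift {n' : SimplexCategory} (ψ : n' ⟶ n) (b : StrictInfFunctor (oriental m) B)
    (z : StrictInfFunctor (oriental (0 + 1 + n.len)) B)
    (h : b.map 0 (NuCell.vertex m (Fin.last m)) = z.map 0 (NuCell.vertex _ 0))
    (h' : b.map 0 (NuCell.vertex m (Fin.last m)) =
      (z.comp (orientalMap (shift 0 ψ).toOrderHom)).map 0 (NuCell.vertex _ 0)) :
    (extend b z h).comp (orientalMap (shift m ψ).toOrderHom) =
      extend b (z.comp (orientalMap (shift 0 ψ).toOrderHom)) h' := by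
  refine eq_extend h' ?_ ?_ ?_
  · exact (congrArg (extend b z h).comp ((orientalMap_comp (initialIncl m n') (shift m ψ)).trans
      (by rw [initialIncl_shift]))).trans (extend_comp_initialIncl b z h)
  · refine (congrArg (extend b z h).comp ((orientalMap_comp (tail m n') (shift m ψ)).trans
      ((by rw [tail_shift] : _ = orientalMap (shift 0 ψ ≫ tail m n).toOrderHom).trans
        (orientalMap_comp (shift 0 ψ) (tail m n)).symm))).trans ?_
    exact congrArg (fun K => StrictInfFunctor.comp K (orientalMap (shift 0 ψ).toOrderHom))
      (extend_comp_tail b z h)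
  -- Invariance passes along `shift m ψ` because `constZero n` pulls back to `constZero n'`.
  · have e := deform_comp_shift m (constZero n) ψ
    rw [comp_constZero] at e
    have e₁ : (extend b z h).comp ((deform m (constZero n)).comp
        (orientalMap (shift m ψ).toOrderHom)) =
          (extend b z h).comp (orientalMap (shift m ψ).toOrderHom) :=
      congrArg (fun K => StrictInfFunctor.comp K (orientalMap (shift m ψ).toOrderHom))
        (extend_comp_deform b z h (constZero n))
    rw [e] at e₁
    exact e₁

end

end CosliceIndex

/-! ### Strong deformation retracts -/

/-- `SSet.Homotopy` is relative to the empty subcomplex, so its `rel` condition is vacuous. -/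
lemma SSet.bot_tensor_hom_ext {X Z : SSet.{u}}
    (g h : ((⊥ : X.Subcomplex) : SSet.{u}) ⊗ Δ[1] ⟶ Z) : g = h := by
  ext n p
  exact False.elim p.1.2

/-- Precomposition with `s` is a left inverse of precomposition with `r`, and `H.h ≫ g` joins `r ≫ s
≫ g` to `g`. -/
lemma IsStrongDeformationRetract.isSimplicialWeakEquivalence {X Y : SSet.{u}} {s : Y ⟶ X}
    {r : X ⟶ Y} (h : IsStrongDeformationRetract s r) : IsSimplicialWeakEquivalence r := by
  obtain ⟨hs, H, -⟩ := h
  intro Z _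
  constructor
  · have hl : Function.LeftInverse (HomotopyClasses.precomp s Z) (HomotopyClasses.precomp r Z) := by
      rintro ⟨g⟩
      change Quot.mk _ (s ≫ r ≫ g) = Quot.mk _ g
      rw [← Category.assoc, hs, Category.id_comp]
    exact hl.injective
  · rintro ⟨g⟩
    refine ⟨Quot.mk _ (s ≫ g), Quot.sound ⟨?_⟩⟩
    exact
      { h := H.h ≫ g
        h₀ := by
          rw [← Category.assoc, H.h₀, Category.assoc]
          rfl
        h₁ := by
          rw [← Category.assoc, H.h₁, Category.id_comp]
          rfl
        rel := SSet.bot_tensor_hom_ext _ _ }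

/-! ### The section and the homotopy on `b \ NA`. -/

namespace StreetCoslice

open CosliceIndex

variable {A B : StrictInfCat.{u}} (f : streetNerve A ⟶ streetNerve B) {m : ℕ}
  (b : streetNerve B _⦋m⦌)

lemma map_vertex_eq {n : SimplexCategoryᵒᵖ} (p : (coslice f (lastVertex b)).obj n) :
    StrictInfFunctor.map b 0 (NuCell.vertex m (Fin.last m)) =
      StrictInfFunctor.map p.1.1 0 (NuCell.vertex (0 + 1 + n.unop.len) 0) := by
  have h := congrArg (fun K => StrictInfFunctor.map K 0 (NuCell.vertex 0 0)) p.2.1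
  refine Eq.trans ?_ (h.symm.trans ?_)
  · exact congrArg (StrictInfFunctor.map b 0)
      (orientalMap_vertex (SimplexCategory.const ⦋0⦌ ⦋m⦌ (Fin.last m)).toOrderHom 0).symm
  · exact congrArg (StrictInfFunctor.map p.1.1 0)
      (orientalMap_vertex (initialIncl 0 n.unop).toOrderHom 0)

/-- The section of `b \ NA ⟶ b_m \ NA` given by gluing with `b`. -/
noncomputable def sec : coslice f (lastVertex b) ⟶ coslice f b where
  app n := ↾fun p => ⟨(extend b p.1.1 (map_vertex_eq f b p), p.1.2), by
    constructor
    · exact extend_comp_initialIncl b p.1.1 (map_vertex_eq f b p)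
    · refine Eq.trans ?_ p.2.2
      -- The face `m+1, …, m+1+n` lies in the tail, where the extension restricts to `p.1.1`.
      have e := orientalMap_comp (finalIncl 0 n.unop) (tail m n.unop)
      rw [finalIncl_tail] at e
      refine (congrArg (extend b p.1.1 (map_vertex_eq f b p)).comp e.symm).trans ?_
      exact congrArg (fun K => StrictInfFunctor.comp K (orientalMap (finalIncl 0 n.unop).toOrderHom))
        (extend_comp_tail b p.1.1 (map_vertex_eq f b p))⟩
  naturality n n' ψ := by
    apply ConcreteCategory.hom_ext
    intro p
    refine Subtype.ext (Prod.ext ?_ rfl)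
    exact (extend_comp_shift ψ.unop b p.1.1 (map_vertex_eq f b p)
      (map_vertex_eq f b ((coslice f (lastVertex b)).map ψ p))).symm

lemma sec_comp : sec f b ≫ cosliceToLastVertex f b = 𝟙 _ := by
  ext n p
  refine Subtype.ext (Prod.ext ?_ rfl)
  exact extend_comp_tail b p.1.1 (map_vertex_eq f b p)

/-- The deformation of `b \ NA` onto the image of `b_m \ NA`. -/
noncomputable def homotopyHom : coslice f b ⊗ Δ[1] ⟶ coslice f b where
  app n := ↾fun p => ⟨(StrictInfFunctor.comp p.1.1.1 (deform m (SSet.stdSimplex.objEquiv p.2)),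
      p.1.1.2), by
    constructor
    -- Both boundary conditions persist: `φ` fixes the face `0, …, m` and `μ` fixes the face `m+1,
    -- …, m+1+n`.
    · refine Eq.trans ?_ p.1.2.1
      exact congrArg (StrictInfFunctor.comp p.1.1.1)
        (deform_comp_orientalMap m _ (initialIncl m n.unop) (Or.inl (initialIncl_comp_collapse m _)))
    · refine Eq.trans ?_ p.1.2.2
      exact congrArg (StrictInfFunctor.comp p.1.1.1)
        (deform_comp_orientalMap m _ (finalIncl m n.unop) (Or.inr (finalIncl_comp_tailProj m)))⟩
  naturality n n' ψ := by
    apply ConcreteCategory.hom_ext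
    intro p
    refine Subtype.ext (Prod.ext ?_ rfl)
    exact congrArg (StrictInfFunctor.comp p.1.1.1)
      (deform_comp_shift m (SSet.stdSimplex.objEquiv p.2) ψ.unop).symm

/-- The homotopy from the composite of `b \ NA ⟶ b_m \ NA` and its section to the identity. -/
noncomputable def homotopy :
    SSet.Homotopy (cosliceToLastVertex f b ≫ sec f b) (𝟙 (coslice f b)) where
  h := homotopyHom f b
  h₀ := by
    ext n p
    refine Subtype.ext (Prod.ext ?_ rfl)
    exact comp_deform_eq_extend _ (fun _ => rfl) p.1.1
      (map_vertex_eq f b ((cosliceToLastVertex f b).app n p)) p.2.1 rfl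
  h₁ := by
    ext n p
    refine Subtype.ext (Prod.ext ?_ rfl)
    exact (congrArg (StrictInfFunctor.comp p.1.1) (deform_of_eq_one m _ fun _ => rfl)).trans
      (comp_orientalMap_id _)
  rel := SSet.bot_tensor_hom_ext _ _

lemma isStrongDeformationRetract :
    IsStrongDeformationRetract (sec f b) (cosliceToLastVertex f b) := by
  refine ⟨sec_comp f b, homotopy f b, ?_⟩
  ext n p
  refine Subtype.ext (Prod.ext ?_ rfl)
  exact extend_comp_deform b p.1.1.1 (map_vertex_eq f b p.1) _

end StreetCoslice

theorem mainTheorem2 (A B : StrictInfCat.{u}) (f : streetNerve A ⟶ streetNerve B) (m : ℕ)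
    (b : streetNerve B _⦋m⦌) :
    (∃ s : coslice f (lastVertex b) ⟶ coslice f b,
      IsStrongDeformationRetract s (cosliceToLastVertex f b)) ∧
    IsSimplicialWeakEquivalence (cosliceToLastVertex f b) :=
  ⟨⟨_, StreetCoslice.isStrongDeformationRetract f b⟩,
    (StreetCoslice.isStrongDeformationRetract f b).isSimplicialWeakEquivalence⟩
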